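/- For a prime $p$ and $d\in\mathbb N$ put $\ell_p(d)=\lceil\log_p(d+1)\rceil$. Write $[a,b]$ for the set of integers between $a$ and $b$. For $E\subseteq[0,n]$ let $\underline E\subseteq\{0,1\}^n$ be the set of points whose Hamming weight lies in $E$. For $S\subseteq\{0,1\}^n\subseteq\mathbb F_p^n$, the degree-$d$ Zariski closure $\mathrm{Z\text{-}cl}_{n,d}(S)$ is the set of common zeros in $\{0,1\}^n$ of all polynomials in $\mathbb F_p[X_1,\dots,X_n]$ of degree at most $d$ that vanish at every point of $S$. There are a deterministic algorithm and a polynomial $q$ such that the following holds for all primes $p$, all $d,n\in\mathbb N$ with $n\ge 4p^{\ell_p(d)}-1$, and all $E\subseteq[d,n-d]$: the closure $\mathrm{Z\text{-}cl}_{n,d}(\underline E)$ equals $\underline F$ for a (unique) set $F\subseteq[0,n]$, and on input $(p,n,d,E)$, with $E$ given by its indicator vector, the algorithm outputs the indicator vector of $F$ on $[0,n]$ after at most $q(n)$ steps. Here algorithms are programs of a unit-cost random access machine on natural numbers, with addition and truncated subtraction as its only arithmetic operations (a model that is polynomially equivalent to Turing machines). -/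

import Mathlib

/-! ### The finite-degree Zariski closure on the Boolean cube -/

/-- The number `ℓ_p(d) = ⌈log_p (d + 1)⌉`. -/
def ellP (p d : ℕ) : ℕ := Nat.clog p (d + 1)

/-- The point of `𝔽_p ^ n` with coordinates `0, 1` given by an element of the Boolean cube. -/
def cubePoint (p : ℕ) {n : ℕ} (x : Fin n → Bool) : Fin n → ZMod p :=
  fun i => if x i = true then 1 else 0

/-- The Hamming weight: the number of coordinates equal to one. -/
def cubeWeight {n : ℕ} (x : Fin n → Bool) : ℕ :=
  (Finset.univ.filter fun i => x i = true).card

/-- The symmetric subset of the cube `{0,1}^n` determined by a set `E` of Hamming weights. -/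
def symSet (n : ℕ) (E : Finset ℕ) : Set (Fin n → Bool) :=
  {x | cubeWeight x ∈ E}

/-- The degree-`d` Zariski closure, over `𝔽_p`, of a subset `S` of the cube `{0,1}^n`: the common
zeros in the cube of all polynomials of degree at most `d` that vanish on `S`. -/
def zClosure (p n d : ℕ) (S : Set (Fin n → Bool)) : Set (Fin n → Bool) :=
  {x | ∀ f : MvPolynomial (Fin n) (ZMod p), f.totalDegree ≤ d →
    (∀ y ∈ S, MvPolynomial.eval (cubePoint p y) f = 0) →
      MvPolynomial.eval (cubePoint p x) f = 0}

/-! ### Random access machines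

The unit-cost random access machine with addition and truncated subtraction as its only
arithmetic.  As there is no multiplication, numbers gain at most one bit per step (beyond the bits
of the input and of the constants of the program), so that this model is polynomially equivalent
to Turing machines. -/

namespace Ram

/-- A memory state: registers, and arrays of natural numbers with unbounded index range.  A program
names finitely many registers and finitely many arrays. -/
structure Store where
  reg : ℕ → ℕ
  arr : ℕ → ℕ → ℕ

/-- The state after `x := v`. -/
def Store.setReg (s : Store) (x v : ℕ) : Store :=
  { s with reg := Function.update s.reg x v }

/-- The state after `a[i] := v`. -/
def Store.setArr (s : Store) (a i v : ℕ) : Store :=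
  { s with arr := Function.update s.arr a (Function.update (s.arr a) i v) }

/-- Programs.  Here `x, y, z` are names of registers, `a` is the name of an array, and `c` is a
numerical constant. -/
inductive Prog : Type
  /-- `x := c` -/
  | const (x c : ℕ) : Prog
  /-- `x := y + z` -/
  | add (x y z : ℕ) : Prog
  /-- `x := max (y - z) 0` -/
  | sub (x y z : ℕ) : Prog
  /-- `x := a[y]` -/
  | load (x a y : ℕ) : Prog
  /-- `a[x] := y` -/
  | store (a x y : ℕ) : Prog
  /-- first `P`, then `Q` -/
  | seq (P Q : Prog) : Prog
  /-- if `x ≠ 0` then `P` else `Q` -/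
  | ite (x : ℕ) (P Q : Prog) : Prog
  /-- while `x ≠ 0` do `P` -/
  | while (x : ℕ) (P : Prog) : Prog

/-- `Exec P s t s'`: started in state `s`, the program `P` halts after exactly `t` steps in the
state `s'`.  Every elementary instruction and every test of a register is one step. -/
inductive Exec : Prog → Store → ℕ → Store → Prop
  | const (x c : ℕ) (s : Store) : Exec (.const x c) s 1 (s.setReg x c)
  | add (x y z : ℕ) (s : Store) : Exec (.add x y z) s 1 (s.setReg x (s.reg y + s.reg z))
  | sub (x y z : ℕ) (s : Store) : Exec (.sub x y z) s 1 (s.setReg x (s.reg y - s.reg z))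
  | load (x a y : ℕ) (s : Store) : Exec (.load x a y) s 1 (s.setReg x (s.arr a (s.reg y)))
  | store (a x y : ℕ) (s : Store) : Exec (.store a x y) s 1 (s.setArr a (s.reg x) (s.reg y))
  | seq {P Q : Prog} {s s' s'' : Store} {t t' : ℕ} :
      Exec P s t s' → Exec Q s' t' s'' → Exec (.seq P Q) s (t + t') s''
  | ite_true {x : ℕ} {P Q : Prog} {s s' : Store} {t : ℕ} :
      s.reg x ≠ 0 → Exec P s t s' → Exec (.ite x P Q) s (t + 1) s'
  | ite_false {x : ℕ} {P Q : Prog} {s s' : Store} {t : ℕ} :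
      s.reg x = 0 → Exec Q s t s' → Exec (.ite x P Q) s (t + 1) s'
  | while_true {x : ℕ} {P : Prog} {s s' s'' : Store} {t t' : ℕ} :
      s.reg x ≠ 0 → Exec P s t s' → Exec (.while x P) s' t' s'' →
        Exec (.while x P) s (t + t' + 1) s''
  | while_false {x : ℕ} {P : Prog} {s : Store} :
      s.reg x = 0 → Exec (.while x P) s 1 s

/-- The input `(p, n, d, E)`: the numbers `p, n, d` stand in the registers `0, 1, 2`, the indicator
vector of `E` stands in the array `0`, and all other cells hold `0`. -/
def inputStore (p n d : ℕ) (E : Finset ℕ) : Store where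
  reg := fun x => if x = 0 then p else if x = 1 then n else if x = 2 then d else 0
  arr := fun a i => if a = 0 ∧ i ∈ E then 1 else 0

/-- The output is the set `F ⊆ [0, n]`: its indicator vector stands in the array `1`. -/
def Outputs (s : Store) (n : ℕ) (F : Finset ℕ) : Prop :=
  ∀ j ≤ n, s.arr 1 j = if j ∈ F then 1 else 0

end Ram

/-! The closure is first reduced to a question about binomial coefficients modulo `p`, which is then
solved by a recursion on base-`p` digits that a machine can run.

On the slice of weight `k`, the monomials `x_I` of ballot sets `I` with `|I| ≤ min(k, n - k)` are a
basis of the functions (`ballot_independent`, `exists_ballot_sum_eq`). Applying the spanning half to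
the coefficients of `f` in each degree writes any `f` of degree at most `d` as a sum of `x_I *
g_I(|x| - |I|)` over ballot sets with `|I| ≤ d`, where `g_I` is a combination of the `choose r` with
`r ≤ d - |I|` (`exists_eval_eq_ballot_sum`). Since `E` lies in `[d, n - d]`, independence holds on
every slice of weight in `E`, so `f` vanishes on the symmetric set exactly if every `g_I` vanishes
on `E - |I|`. Hence `x` is in the closure iff for all `i ≤ min(d, |x|)` the number `|x| - i` lies in
the binomial closure of `E - i` in degree `d - i` (`mem_zClosure_symSet_iff`). This depends on the
weight of `x` only.

By Lucas, binomial combinations of degree `D < p ^ (k + 1)` have period `p ^ (k + 1)`. Write `u = y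
+ p ^ k * t` and `T = D / p ^ k`. On the fibre over `y` a combination is a polynomial in `t` of
degree at most `T < p`; its lower coefficients are arbitrary functions of `y`, while the coefficient
of degree `T` is a binomial combination of degree `D % p ^ k`. Counting roots in the fibres removes
one digit (`inBinomialClosure_succ_iff`), and iteration gives `InDigitClosure`.

The machine evaluates this recursion for all weights `j ≤ n` and all `i ≤ d`. As `p ^ ℓ ≤ n + 1`,
even arithmetic by repeated addition and subtraction takes polynomial time. -/

/-! ### Ballot monomials as a basis of the functions on a slice. -/

/-- The subsets of `{0, …, n - 1}` that contain at most half of every initial segment. -/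
def Ballot : ℕ → Finset ℕ → Prop
  | 0, I => I = ∅
  | n + 1, I => if n ∈ I then Ballot n (I.erase n) ∧ 2 * I.card ≤ n + 1 else Ballot n I

theorem Ballot.subset {n : ℕ} {I : Finset ℕ} (h : Ballot n I) : I ⊆ Finset.range n := by
  induction n generalizing I with
  | zero => simp [Ballot] at h; simp [h]
  | succ n ih =>
    rw [Ballot] at h
    split_ifs at h with hn
    · intro x hx
      by_cases hxn : x = n
      · simp [hxn]
      · have := ih h.1 (Finset.mem_erase.2 ⟨hxn, hx⟩)
        simp at this ⊢; omega
    · exact (ih h).trans (Finset.range_mono (by omega))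

theorem Ballot.card_le {n : ℕ} {I : Finset ℕ} (h : Ballot n I) : 2 * I.card ≤ n := by
  induction n generalizing I with
  | zero => simp [Ballot] at h; simp [h]
  | succ n ih =>
    rw [Ballot] at h
    split_ifs at h with hn
    · exact h.2
    · have := ih h; omega

theorem ballot_insert {n : ℕ} {I : Finset ℕ} (hn : n ∉ I) :
    Ballot (n + 1) (insert n I) ↔ Ballot n I ∧ 2 * (I.card + 1) ≤ n + 1 := by
  simp [Ballot, Finset.card_insert_of_notMem hn, Finset.erase_insert hn]

theorem ballot_succ_of_notMem {n : ℕ} {I : Finset ℕ} (hn : n ∉ I) :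
    Ballot (n + 1) I ↔ Ballot n I := by
  simp [Ballot, hn]

/-- On a slice of the cube, the squarefree monomials of small degree that belong to ballot sets
are linearly independent. -/
theorem ballot_independent {F : Type*} [Field F] {n m k : ℕ} (hmk : m ≤ k) (hkn : m + k ≤ n)
    (c : Finset ℕ → F) (hc : ∀ I, c I ≠ 0 → Ballot n I ∧ I.card ≤ m)
    (h : ∀ Y ⊆ Finset.range n, Y.card = k → ∑ I ∈ Y.powerset, c I = 0) (I : Finset ℕ) :
    c I = 0 := by
  induction n generalizing m k c I with
  | zero =>
    obtain rfl : k = 0 := by omega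
    by_contra hI
    obtain ⟨h1, -⟩ := hc I hI
    obtain rfl : I = ∅ := h1
    exact hI (by simpa using h ∅ (by simp) rfl)
  | succ n ih =>
    -- Split by the last coordinate: `c0` alone vanishes on the slice of weight `k` in dimension
    -- `n`, and `c0 + c1` on the slice of weight `k - 1`.
    set c0 : Finset ℕ → F := fun I => if n ∈ I then 0 else c I with hc0
    set c1 : Finset ℕ → F := fun I => if n ∈ I then 0 else c (insert n I) with hc1
    have hc0' : ∀ I, c0 I ≠ 0 → Ballot n I ∧ I.card ≤ m := by
      intro I hI
      simp only [hc0] at hI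
      split_ifs at hI with hn
      · simp at hI
      · obtain ⟨h1, h2⟩ := hc I hI
        exact ⟨(ballot_succ_of_notMem hn).1 h1, h2⟩
    have hc1' : ∀ I, c1 I ≠ 0 → Ballot n I ∧ I.card + 1 ≤ m := by
      intro I hI
      simp only [hc1] at hI
      split_ifs at hI with hn
      · simp at hI
      · obtain ⟨h1, h2⟩ := hc _ hI
        rw [Finset.card_insert_of_notMem hn] at h2
        exact ⟨((ballot_insert hn).1 h1).1, h2⟩
    have hY0 : ∀ Y ⊆ Finset.range n, Y.card = k → ∑ I ∈ Y.powerset, c0 I = 0 := by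
      intro Y hY hk
      rw [← h Y (hY.trans (Finset.range_mono (by omega))) hk]
      refine Finset.sum_congr rfl fun I hI => ?_
      have : n ∉ I := fun hn => by simpa using hY (Finset.mem_powerset.1 hI hn)
      simp [hc0, this]
    have hY1 : ∀ Y ⊆ Finset.range n, Y.card + 1 = k →
        ∑ I ∈ Y.powerset, (c0 I + c1 I) = 0 := by
      intro Y hY hk
      have hnY : n ∉ Y := fun hn => by simpa using hY hn
      rw [← h (insert n Y) ?_ (by rw [Finset.card_insert_of_notMem hnY, hk]),
        Finset.sum_powerset_insert hnY, Finset.sum_add_distrib]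
      · congr 1 <;> refine Finset.sum_congr rfl fun I hI => ?_ <;>
        · have : n ∉ I := fun hn => hnY (Finset.mem_powerset.1 hI hn)
          simp [hc0, hc1, this]
      · intro x hx
        rcases Finset.mem_insert.1 hx with rfl | hx
        · simp
        · have := hY hx
          simp at this ⊢; omega
    suffices H : (∀ I, c0 I = 0) ∧ ∀ I, c1 I = 0 by
      by_cases hn : n ∈ I
      · have := H.2 (I.erase n)
        simpa [hc1, Finset.insert_erase hn] using this
      · simpa [hc0, hn] using H.1 I
    have finish : (∀ I, c0 I = 0) → ∀ I, c1 I = 0 := by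
      intro H I
      by_contra hI
      have hI' := hc1' I hI
      refine hI (ih (m := m - 1) (k := k - 1) (by omega) (by omega) c1 (fun J hJ => ?_) ?_ I)
      · have := hc1' J hJ
        exact ⟨this.1, by omega⟩
      · intro Y hY hk
        rw [← hY1 Y hY (by omega)]
        simp [H]
    by_cases h1 : m + k ≤ n
    · have H := ih hmk h1 c0 hc0' hY0
      exact ⟨H, finish H⟩
    -- Now `m + k = n + 1`, one too many for induction on the slice of weight `k`. A ballot set of
    -- size `m` has `2 * m ≤ n`, so `m < k` and the slice of weight `k - 1` is admissible. There `c0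
    -- + c1` vanishes, and `c1` lives on sizes below `m`; hence `c0` has no term of size `m`, and
    -- `m` can be lowered.
    · have hm : ∀ I, c0 I ≠ 0 → I.card + 1 ≤ m := by
        intro I hI
        obtain ⟨h2, h3⟩ := hc0' I hI
        by_contra h4
        have h5 := h2.card_le
        have h6 := ih (m := m) (k := k - 1) (by omega) (by omega) (fun I => c0 I + c1 I)
          (fun J hJ => ?_) (fun Y hY hk => hY1 Y hY (by omega)) I
        · have h7 : c1 I = 0 := by
            by_contra h8
            exact h4 (hc1' I h8).2
          simp [h7] at h6
          exact hI h6
        · by_cases h7 : c0 J = 0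
          · have := hc1' J (by simpa [h7] using hJ)
            exact ⟨this.1, by omega⟩
          · exact hc0' J h7
      have H : ∀ I, c0 I = 0 := by
        intro I
        by_contra hI
        have := hm I hI
        exact hI (ih (m := m - 1) (k := k) (by omega) (by omega) c0
          (fun J hJ => ⟨(hc0' J hJ).1, by have := hm J hJ; omega⟩) hY0 I)
      exact ⟨H, finish H⟩

/-- On a slice of the cube, every function is a linear combination of the squarefree monomials of
small degree that belong to ballot sets. -/
theorem exists_ballot_sum_eq {F : Type*} [Field F] {n k : ℕ} (hkn : k ≤ n)
    (h : Finset ℕ → F) :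
    ∃ c : Finset ℕ → F, (∀ I, c I ≠ 0 → Ballot n I ∧ I.card ≤ k ∧ I.card + k ≤ n) ∧
      ∀ Y ⊆ Finset.range n, Y.card = k → ∑ I ∈ Y.powerset, c I = h Y := by
  induction n generalizing k h with
  | zero =>
    obtain rfl : k = 0 := by omega
    refine ⟨fun I => if I = ∅ then h ∅ else 0, fun I hI => ?_, fun Y hY hk => ?_⟩
    · have : I = ∅ := by by_contra h'; simp [h'] at hI
      simp [this, Ballot]
    · simp at hY
      simp [hY]
  | succ n ih =>
    suffices H : ∃ c0 c1 : Finset ℕ → F,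
        (∀ I, c0 I ≠ 0 → Ballot n I ∧ I.card ≤ k ∧ I.card + k ≤ n + 1) ∧
        (∀ I, c1 I ≠ 0 → Ballot n I ∧ I.card + 1 ≤ k ∧ I.card + k ≤ n) ∧
        (∀ Y ⊆ Finset.range n, Y.card = k → ∑ I ∈ Y.powerset, c0 I = h Y) ∧
        (∀ Y ⊆ Finset.range n, Y.card + 1 = k →
          ∑ I ∈ Y.powerset, (c0 I + c1 I) = h (insert n Y)) by
      obtain ⟨c0, c1, hc0, hc1, hY0, hY1⟩ := H
      refine ⟨fun I => if n ∈ I then c1 (I.erase n) else c0 I, fun I hI => ?_, fun Y hY hk => ?_⟩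
      · by_cases hn : n ∈ I
        · simp only [hn, if_true] at hI
          have h1 := hc1 _ hI
          have h2 := Finset.card_erase_add_one hn
          refine ⟨?_, by omega, by omega⟩
          rw [← Finset.insert_erase hn, ballot_insert (by simp)]
          exact ⟨h1.1, by omega⟩
        · simp only [hn, if_false] at hI
          have h1 := hc0 _ hI
          exact ⟨(ballot_succ_of_notMem hn).2 h1.1, h1.2⟩
      · by_cases hn : n ∈ Y
        · have hY' : Y.erase n ⊆ Finset.range n := fun x hx => by
            have h1 := hY (Finset.mem_of_mem_erase hx)
            have h2 := Finset.ne_of_mem_erase hx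
            simp at h1 ⊢; omega
          have h2 := Finset.card_erase_add_one hn
          have h3 := hY1 _ hY' (by omega)
          rw [Finset.insert_erase hn] at h3
          rw [← h3]
          conv_lhs => rw [← Finset.insert_erase hn]
          rw [Finset.sum_powerset_insert (by simp), Finset.sum_add_distrib]
          congr 1 <;> refine Finset.sum_congr rfl fun I hI => ?_ <;>
          · have : n ∉ I := fun h' => by simpa using Finset.mem_powerset.1 hI h'
            simp [this]
        · have hY' : Y ⊆ Finset.range n := fun x hx => by
            have h1 := hY hx
            have h2 : x ≠ n := fun h' => hn (h' ▸ hx)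
            simp at h1 ⊢; omega
          rw [← hY0 Y hY' hk]
          refine Finset.sum_congr rfl fun I hI => ?_
          have : n ∉ I := fun h' => hn (Finset.mem_powerset.1 hI h')
          simp [this]
    obtain ⟨c, hc, hYc⟩ : ∃ c : Finset ℕ → F,
        (∀ I, c I ≠ 0 → Ballot n I ∧ I.card + 1 ≤ k ∧ I.card + k ≤ n + 1) ∧
        ∀ Y ⊆ Finset.range n, Y.card + 1 = k → ∑ I ∈ Y.powerset, c I = h (insert n Y) := by
      rcases Nat.eq_zero_or_pos k with rfl | hk
      · exact ⟨0, by simp, by simp⟩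
      · obtain ⟨c, hc, hY⟩ := ih (k := k - 1) (by omega) (fun Y => h (insert n Y))
        refine ⟨c, fun I hI => ?_, fun Y hYn hYk => hY Y hYn (by omega)⟩
        have := hc I hI
        exact ⟨this.1, by omega, by omega⟩
    -- The terms of `c` of size `n + 1 - k` are too large for `c1`, but `c0` may contain them. They
    -- are moved there, and `c'` corrects the values on the sets without `n`.
    set b : Finset ℕ → F := fun I => if I.card + k = n + 1 then c I else 0 with hb
    obtain ⟨c', hc', hYc'⟩ : ∃ c' : Finset ℕ → F,
        (∀ I, c' I ≠ 0 → Ballot n I ∧ I.card ≤ k ∧ I.card + k ≤ n) ∧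
        ∀ Y ⊆ Finset.range n, Y.card = k → ∑ I ∈ Y.powerset, c' I =
          h Y - ∑ I ∈ Y.powerset, b I := by
      rcases Nat.lt_or_ge n k with hk | hk
      · refine ⟨0, by simp, fun Y hY hYk => ?_⟩
        have := Finset.card_le_card hY
        simp at this; omega
      · exact ih hk _
    -- The cutoff in `c1` is invisible on sets of size `k - 1`, whose subsets all satisfy it.
    refine ⟨fun I => b I + c' I, fun I => if I.card + 1 ≤ k then c I - (b I + c' I) else 0,
      fun I hI => ?_, fun I hI => ?_,
      fun Y hY hk => ?_, fun Y hY hk => ?_⟩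
    · by_cases h1 : c' I = 0
      · have h2 : b I ≠ 0 := by simpa [h1] using hI
        have h3 : c I ≠ 0 := by
          intro h3
          simp [hb, h3] at h2
        have := hc I h3
        exact ⟨this.1, by omega, by omega⟩
      · have := hc' I h1
        exact ⟨this.1, by omega, by omega⟩
    · have hIk : I.card + 1 ≤ k := by
        by_contra h1
        simp [h1] at hI
      simp only [hIk, if_true] at hI
      by_cases h1 : c' I = 0
      · have h2 : I.card + k ≠ n + 1 := fun h2 => by simp [hb, h1, h2] at hI
        have h3 : c I ≠ 0 := by simpa [hb, h1, h2] using hI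
        have := hc I h3
        exact ⟨this.1, by omega, by omega⟩
      · have := hc' I h1
        exact ⟨this.1, by omega, by omega⟩
    · rw [Finset.sum_add_distrib, hYc' Y hY hk]; ring
    · rw [← hYc Y hY hk]
      refine Finset.sum_congr rfl fun I hI => ?_
      have := Finset.card_le_card (Finset.mem_powerset.1 hI)
      simp only [if_pos (show I.card + 1 ≤ k by omega)]
      ring

/-! ### From polynomials on the cube to binomial combinations of the weight. -/

/-- The closure of a set of natural numbers with respect to the linear combinations over `𝔽_p` of
the functions `u ↦ u.choose r` with `r ≤ D`. -/
def InBinomialClosure (p D : ℕ) (S : Set ℕ) (u : ℕ) : Prop :=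
  ∀ g : ℕ → ZMod p, (∀ a ∈ S, ∑ r ∈ Finset.range (D + 1), g r * (a.choose r : ZMod p) = 0) →
    ∑ r ∈ Finset.range (D + 1), g r * (u.choose r : ZMod p) = 0

/-- The set of coordinates of a point of the cube that are equal to one. -/
def cubeSupport {n : ℕ} (x : Fin n → Bool) : Finset (Fin n) :=
  Finset.univ.filter fun i => x i = true

theorem card_cubeSupport {n : ℕ} (x : Fin n → Bool) : (cubeSupport x).card = cubeWeight x := rfl

theorem prod_cubePoint_pow {p n : ℕ} (x : Fin n → Bool) (S : Finset (Fin n)) (e : Fin n → ℕ)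
    (he : ∀ i ∈ S, e i ≠ 0) :
    ∏ i ∈ S, cubePoint p x i ^ e i = if S ⊆ cubeSupport x then 1 else 0 := by
  split_ifs with h
  · refine Finset.prod_eq_one fun i hi => ?_
    have : x i = true := by simpa [cubeSupport] using h hi
    simp [cubePoint, this]
  · obtain ⟨i, hi, hx⟩ := Finset.not_subset.1 h
    refine Finset.prod_eq_zero hi ?_
    have : x i = false := by simpa [cubeSupport] using hx
    simp [cubePoint, this, he i hi]

/-- The product of the variables in `I` and the elementary symmetric polynomial of degree `r` in
the other variables. -/
noncomputable def prodMulEsymm (p : ℕ) {n : ℕ} (I : Finset (Fin n)) (r : ℕ) :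
    MvPolynomial (Fin n) (ZMod p) :=
  (∏ i ∈ I, MvPolynomial.X i) *
    ∑ R ∈ (Finset.univ \ I).powersetCard r, ∏ i ∈ R, MvPolynomial.X i

theorem totalDegree_prod_X_le {p n : ℕ} (I : Finset (Fin n)) :
    (∏ i ∈ I, MvPolynomial.X i : MvPolynomial (Fin n) (ZMod p)).totalDegree ≤ I.card := by
  refine (MvPolynomial.totalDegree_finsetProd _ _).trans ?_
  rw [Finset.card_eq_sum_ones]
  refine Finset.sum_le_sum fun i _ => ?_
  refine (MvPolynomial.totalDegree_monomial_le _ _).trans ?_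
  simp

theorem totalDegree_prodMulEsymm_le {p n : ℕ} (I : Finset (Fin n)) (r : ℕ) :
    (prodMulEsymm p I r).totalDegree ≤ I.card + r := by
  refine (MvPolynomial.totalDegree_mul _ _).trans
    (add_le_add (totalDegree_prod_X_le I) (MvPolynomial.totalDegree_finsetSum_le fun R hR => ?_))
  exact (totalDegree_prod_X_le R).trans_eq (Finset.mem_powersetCard.1 hR).2

theorem eval_prodMulEsymm {p n : ℕ} (I : Finset (Fin n)) (r : ℕ) (x : Fin n → Bool) :
    MvPolynomial.eval (cubePoint p x) (prodMulEsymm p I r) =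
      if I ⊆ cubeSupport x then ((cubeWeight x - I.card).choose r : ZMod p) else 0 := by
  have h := fun S : Finset (Fin n) => prod_cubePoint_pow (p := p) x S (fun _ => 1) (by simp)
  simp only [pow_one] at h
  simp only [prodMulEsymm, map_mul, map_prod, map_sum, MvPolynomial.eval_X, h]
  split_ifs with hI
  · rw [one_mul, Finset.sum_boole, ← card_cubeSupport, ← Finset.card_sdiff_of_subset hI,
      ← Finset.card_powersetCard]
    congr 2
    ext R
    simp only [Finset.mem_filter, Finset.mem_powersetCard, Finset.subset_iff, Finset.mem_sdiff,
      Finset.mem_univ, true_and]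
    grind
  · simp

/-- Test polynomials: the product of `i` variables in the support of `x`, times a combination of
elementary symmetric polynomials in the others. It is zero at points whose support does not contain
these variables, and at the others it is the given binomial combination of the weight minus `i`. -/
theorem InBinomialClosure.of_mem_zClosure {p n d i : ℕ} {E : Finset ℕ} {x : Fin n → Bool}
    (hx : x ∈ zClosure p n d (symSet n E)) (hid : i ≤ d) (hix : i ≤ cubeWeight x) :
    InBinomialClosure p (d - i) ((fun e => e - i) '' (E : Set ℕ)) (cubeWeight x - i) := by
  intro g hg
  obtain ⟨I, hI, hIc⟩ := Finset.exists_subset_card_eq (s := cubeSupport x) (n := i) hix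
  have key : ∀ y : Fin n → Bool, MvPolynomial.eval (cubePoint p y)
      (∑ r ∈ Finset.range (d - i + 1), MvPolynomial.C (g r) * prodMulEsymm p I r) =
      if I ⊆ cubeSupport y then
        ∑ r ∈ Finset.range (d - i + 1), g r * ((cubeWeight y - i).choose r : ZMod p) else 0 := by
    intro y
    simp only [map_sum, map_mul, MvPolynomial.eval_C, eval_prodMulEsymm, hIc]
    split_ifs <;> simp
  have := hx (∑ r ∈ Finset.range (d - i + 1), MvPolynomial.C (g r) * prodMulEsymm p I r) ?_ ?_
  · rwa [key, if_pos hI] at this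
  · refine MvPolynomial.totalDegree_finsetSum_le fun r hr => ?_
    refine (MvPolynomial.totalDegree_mul _ _).trans ?_
    have h1 := totalDegree_prodMulEsymm_le (p := p) I r
    simp only [MvPolynomial.totalDegree_C, Finset.mem_range] at hr ⊢
    omega
  · intro y hy
    rw [key]
    split_ifs
    · exact hg _ ⟨_, hy, rfl⟩
    · rfl

/-- Double counting: a subset `I` of `Y` with at most `m` elements lies in `(|Y| - |I|).choose (m -
|I|)` subsets of `Y` of size `m`. -/
theorem sum_powersetCard_sum_powerset {F : Type*} [CommSemiring F] (a : Finset ℕ → F) (m : ℕ)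
    (ha : ∀ I, a I ≠ 0 → I.card ≤ m) (Y : Finset ℕ) :
    ∑ J ∈ Y.powersetCard m, ∑ I ∈ J.powerset, a I =
      ∑ I ∈ Y.powerset, a I * ((Y.card - I.card).choose (m - I.card) : F) := by
  have h1 : ∀ J ∈ Y.powersetCard m, ∑ I ∈ J.powerset, a I =
      ∑ I ∈ Y.powerset, if I ⊆ J then a I else 0 := by
    intro J hJ
    rw [← Finset.sum_filter]
    refine Finset.sum_congr ?_ fun _ _ => rfl
    ext I
    have := (Finset.mem_powersetCard.1 hJ).1
    simp only [Finset.mem_powerset, Finset.mem_filter]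
    exact ⟨fun h => ⟨h.trans this, h⟩, fun h => h.2⟩
  rw [Finset.sum_congr rfl h1, Finset.sum_comm]
  refine Finset.sum_congr rfl fun I hI => ?_
  rw [← Finset.sum_filter, Finset.sum_const, nsmul_eq_mul, mul_comm]
  by_cases h0 : a I = 0
  · simp [h0]
  congr 2
  rw [Finset.mem_powerset] at hI
  rw [← Finset.card_sdiff_of_subset hI, ← Finset.card_powersetCard]
  have hm := ha I h0
  refine Finset.card_bij' (fun J _ => J \ I) (fun R _ => R ∪ I) ?_ ?_ ?_ ?_
  · intro J hJ
    simp only [Finset.mem_filter, Finset.mem_powersetCard] at hJ ⊢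
    exact ⟨Finset.sdiff_subset_sdiff hJ.1.1 le_rfl, by
      rw [Finset.card_sdiff_of_subset hJ.2, hJ.1.2]⟩
  · intro R hR
    simp only [Finset.mem_filter, Finset.mem_powersetCard] at hR ⊢
    have hd : Disjoint R I := Finset.disjoint_of_subset_left hR.1 Finset.sdiff_disjoint
    refine ⟨⟨Finset.union_subset (hR.1.trans Finset.sdiff_subset) hI, ?_⟩,
      Finset.subset_union_right⟩
    rw [Finset.card_union_of_disjoint hd, hR.2]; omega
  · intro J hJ
    simp only [Finset.mem_filter] at hJ
    exact Finset.sdiff_union_of_subset hJ.2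
  · intro R hR
    simp only [Finset.mem_powersetCard] at hR
    have hd : Disjoint R I := Finset.disjoint_of_subset_left hR.1 Finset.sdiff_disjoint
    rw [Finset.union_sdiff_right, hd.sdiff_eq_left]

theorem map_valEmbedding_subset_range {n : ℕ} (S : Finset (Fin n)) :
    S.map Fin.valEmbedding ⊆ Finset.range n := by
  intro a ha
  obtain ⟨i, -, rfl⟩ := Finset.mem_map.1 ha
  simp

theorem exists_map_valEmbedding_eq {n : ℕ} {Y : Finset ℕ} (hY : Y ⊆ Finset.range n) :
    ∃ x : Fin n → Bool, (cubeSupport x).map Fin.valEmbedding = Y := by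
  refine ⟨fun i => decide ((i : ℕ) ∈ Y), ?_⟩
  ext a
  simp only [Finset.mem_map, cubeSupport, Finset.mem_filter, Finset.mem_univ, true_and,
    decide_eq_true_eq, Fin.valEmbedding_apply]
  constructor
  · rintro ⟨i, hi, rfl⟩; exact hi
  · intro h; exact ⟨⟨a, by simpa using hY h⟩, h, rfl⟩

/-- On the cube, a polynomial of degree at most `d` is a linear combination of squarefree monomials
of degree at most `d`. -/
theorem exists_eval_eq_sum_powerset {p n d : ℕ} (f : MvPolynomial (Fin n) (ZMod p))
    (hf : f.totalDegree ≤ d) :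
    ∃ c : Finset ℕ → ZMod p, (∀ J, c J ≠ 0 → J.card ≤ d) ∧ ∀ x : Fin n → Bool,
      MvPolynomial.eval (cubePoint p x) f =
        ∑ J ∈ ((cubeSupport x).map Fin.valEmbedding).powerset, c J := by
  -- On `{0, 1}` a monomial depends only on its support, so the coefficients of equal support are
  -- added.
  refine ⟨fun J => ∑ e ∈ f.support.filter (fun e => e.support.map Fin.valEmbedding = J),
    f.coeff e, fun J hJ => ?_, fun x => ?_⟩
  · obtain ⟨e, he, -⟩ := Finset.exists_ne_zero_of_sum_ne_zero hJ
    obtain ⟨he', rfl⟩ := Finset.mem_filter.1 he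
    rw [Finset.card_map]
    refine le_trans ?_ ((MvPolynomial.le_totalDegree he').trans hf)
    rw [Finset.card_eq_sum_ones]
    exact Finset.sum_le_sum fun i hi => Nat.one_le_iff_ne_zero.2 (Finsupp.mem_support_iff.1 hi)
  · have h1 : ∀ e : Fin n →₀ ℕ, ∏ i ∈ e.support, cubePoint p x i ^ e i =
        if e.support ⊆ cubeSupport x then 1 else 0 := fun e =>
      prod_cubePoint_pow x _ _ fun i hi => Finsupp.mem_support_iff.1 hi
    simp only [MvPolynomial.eval_eq, h1, mul_ite, mul_one, mul_zero]
    rw [← Finset.sum_filter]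
    rw [← Finset.sum_fiberwise_of_maps_to (s := f.support.filter _)
      (t := ((cubeSupport x).map Fin.valEmbedding).powerset)
      (g := fun e => e.support.map Fin.valEmbedding)]
    · refine Finset.sum_congr rfl fun J hJ => Finset.sum_congr ?_ fun _ _ => rfl
      ext e
      simp only [Finset.mem_filter, Finset.mem_powerset] at hJ ⊢
      constructor
      · rintro ⟨⟨h2, -⟩, h3⟩; exact ⟨h2, h3⟩
      · rintro ⟨h2, rfl⟩; exact ⟨⟨h2, Finset.map_subset_map.1 hJ⟩, rfl⟩
    · intro e he
      rw [Finset.mem_powerset]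
      exact Finset.map_subset_map.2 (Finset.mem_filter.1 he).2

open Classical in
/-- A function of degree at most `d ≤ n / 2` on the cube in terms of the monomials of ballot
sets and of functions of the Hamming weight. -/
theorem exists_eval_eq_ballot_sum {p n d : ℕ} [Fact p.Prime] (hdn : 2 * d ≤ n)
    (f : MvPolynomial (Fin n) (ZMod p)) (hf : f.totalDegree ≤ d) :
    ∃ g : Finset ℕ → ℕ → ZMod p, ∀ x : Fin n → Bool,
      MvPolynomial.eval (cubePoint p x) f =
        ∑ I ∈ ((cubeSupport x).map Fin.valEmbedding).powerset,
          if Ballot n I ∧ I.card ≤ d then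
            ∑ r ∈ Finset.range (d - I.card + 1), g I r * ((cubeWeight x - I.card).choose r : ZMod p)
          else 0 := by
  obtain ⟨c, hc, hfc⟩ := exists_eval_eq_sum_powerset f hf
  -- The coefficients in degree `m` are regarded as a function on the slice of weight `m` and
  -- expanded in ballot monomials there.
  have h1 : ∀ m, ∃ a : Finset ℕ → ZMod p,
      (∀ I, a I ≠ 0 → Ballot n I ∧ I.card ≤ m ∧ m ≤ d) ∧
      ∀ J ⊆ Finset.range n, J.card = m → ∑ I ∈ J.powerset, a I = c J := by
    intro m
    by_cases hm : m ≤ d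
    · obtain ⟨a, ha, h⟩ := exists_ballot_sum_eq (n := n) (k := m) (by omega) c
      exact ⟨a, fun I hI => ⟨(ha I hI).1, (ha I hI).2.1, hm⟩, h⟩
    · refine ⟨0, by simp, fun J _ hJ => ?_⟩
      by_contra h
      exact hm (hJ ▸ hc J (by simpa [eq_comm] using h))
  choose a ha hac using h1
  refine ⟨fun I r => a (I.card + r) I, fun x => ?_⟩
  set Y := (cubeSupport x).map Fin.valEmbedding with hY
  have hYn : Y ⊆ Finset.range n := map_valEmbedding_subset_range _
  have hYc : Y.card = cubeWeight x := Finset.card_map _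
  rw [hfc, ← hY, Finset.sum_powerset]
  have h2 : ∀ m, ∑ J ∈ Y.powersetCard m, c J =
      ∑ I ∈ Y.powerset, a m I * ((Y.card - I.card).choose (m - I.card) : ZMod p) := by
    intro m
    rw [← sum_powersetCard_sum_powerset (a m) m (fun I hI => (ha m I hI).2.1)]
    refine Finset.sum_congr rfl fun J hJ => ?_
    rw [Finset.mem_powersetCard] at hJ
    exact (hac m J (hJ.1.trans hYn) hJ.2).symm
  simp only [h2]
  rw [Finset.sum_comm]
  refine Finset.sum_congr rfl fun I hI => ?_
  have hIY := Finset.card_le_card (Finset.mem_powerset.1 hI)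
  -- Sums over `m ≤ |Y|` and over `m ≤ d` agree: beyond `d` the coefficients vanish, beyond `|Y|`
  -- the binomials do.
  have h3 : ∀ N, d ≤ N → ∑ m ∈ Finset.range (N + 1),
      a m I * ((Y.card - I.card).choose (m - I.card) : ZMod p) =
      ∑ m ∈ Finset.range (d + 1),
      a m I * ((Y.card - I.card).choose (m - I.card) : ZMod p) := by
    intro N hN
    symm
    refine Finset.sum_subset (Finset.range_mono (by omega)) fun m _ hm => ?_
    have : a m I = 0 := by
      by_contra h
      have := (ha m I h).2.2
      simp at hm; omega
    simp [this]
  have h4 : ∑ m ∈ Finset.range (Y.card + 1),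
      a m I * ((Y.card - I.card).choose (m - I.card) : ZMod p) =
      ∑ m ∈ Finset.range (d + 1),
      a m I * ((Y.card - I.card).choose (m - I.card) : ZMod p) := by
    rw [← h3 _ (le_max_right Y.card d)]
    refine Finset.sum_subset (Finset.range_mono (by omega)) fun m _ hm => ?_
    simp only [Finset.mem_range] at hm
    rw [Nat.choose_eq_zero_of_lt (by omega)]
    simp
  rw [h4]
  split_ifs with hb
  · rw [show d + 1 = I.card + (d - I.card + 1) by omega, Finset.sum_range_add]
    rw [Finset.sum_eq_zero, zero_add]
    · refine Finset.sum_congr (by congr 1) fun r _ => ?_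
      rw [hYc, Nat.add_sub_cancel_left]
    · intro m hm
      have : a m I = 0 := by
        by_contra h
        have := (ha m I h).2.1
        simp at hm; omega
      simp [this]
  · refine Finset.sum_eq_zero fun m _ => ?_
    have : a m I = 0 := by
      by_contra h
      have := ha m I h
      exact hb ⟨this.1, by omega⟩
    simp [this]

-- For `e` in `E` one has `d ≤ e` and `d + e ≤ n`, exactly what `ballot_independent` needs in degree
-- `d`. So a polynomial vanishing on the slice of weight `e` has all its weight coefficients zero at
-- `e`, and the closure condition carries these zeros to the weight of `x`.
open Classical in
theorem mem_zClosure_symSet_iff {p n d : ℕ} [Fact p.Prime] (hdn : 2 * d ≤ n) {E : Finset ℕ}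
    (hE : E ⊆ Finset.Icc d (n - d)) (x : Fin n → Bool) :
    x ∈ zClosure p n d (symSet n E) ↔ ∀ i ≤ d, i ≤ cubeWeight x →
      InBinomialClosure p (d - i) ((fun e => e - i) '' (E : Set ℕ)) (cubeWeight x - i) := by
  refine ⟨fun hx i hid hix => InBinomialClosure.of_mem_zClosure hx hid hix, fun H f hf hfE => ?_⟩
  obtain ⟨g, hg⟩ := exists_eval_eq_ballot_sum hdn f hf
  set G : ℕ → Finset ℕ → ZMod p := fun w I => if Ballot n I ∧ I.card ≤ d then
    ∑ r ∈ Finset.range (d - I.card + 1), g I r * ((w - I.card).choose r : ZMod p) else 0 with hG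
  have h1 : ∀ e ∈ E, ∀ I, G e I = 0 := by
    intro e he I
    have he' := Finset.mem_Icc.1 (hE he)
    refine ballot_independent (n := n) (m := d) (k := e) (by omega) (by omega) (G e) ?_ ?_ I
    · intro I hI
      by_contra h
      exact hI (if_neg h)
    · intro Y hY hYe
      obtain ⟨y, rfl⟩ := exists_map_valEmbedding_eq hY
      have hye : cubeWeight y = e := by rw [← hYe, Finset.card_map, card_cubeSupport]
      have := hg y
      rw [hfE y (by simpa [symSet, hye] using he), hye] at this
      exact this.symm
  rw [hg]
  refine Finset.sum_eq_zero fun I hI => ?_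
  split_ifs with hb
  · have h2 := Finset.card_le_card (Finset.mem_powerset.1 hI)
    rw [Finset.card_map, card_cubeSupport] at h2
    refine H I.card hb.2 h2 (g I) ?_
    rintro _ ⟨e, he, rfl⟩
    simpa [hG, hb] using h1 e he I
  · rfl

/-! ### Lucas' theorem and the removal of one base-`p` digit. -/

/-- The sum of `a` over the progression `y, y + q, …, y + (p - 1) q`. -/
def fiberCount (p q : ℕ) (a : ℕ → ℕ) (y : ℕ) : ℕ :=
  ∑ t ∈ Finset.range p, a (y + q * t)

/-- The residues whose fibre has more than `T` elements. -/
def heavyResidues (p q T : ℕ) (a : ℕ → ℕ) (y : ℕ) : ℕ :=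
  if T < fiberCount p q a y then 1 else 0

/-- The closure of the set with indicator function `a` on `{0, …, p ^ k - 1}`, computed digit by
digit in base `p`. -/
def InDigitClosure (p : ℕ) : ℕ → (ℕ → ℕ) → ℕ → ℕ → Prop
  | 0, a, _, u => a u ≠ 0
  | k + 1, a, D, u => a u ≠ 0 ∨
      (D / p ^ k ≤ fiberCount p (p ^ k) a (u % p ^ k) ∧
        InDigitClosure p k (heavyResidues p (p ^ k) (D / p ^ k) a) (D % p ^ k) (u % p ^ k))

theorem choose_cast_eq_mod_mul_div (p : ℕ) [Fact p.Prime] (k n r : ℕ) :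
    (n.choose r : ZMod p) =
      (n % p ^ k).choose (r % p ^ k) * (n / p ^ k).choose (r / p ^ k) := by
  have lucas : ∀ n r : ℕ, (n.choose r : ZMod p) =
      (n % p).choose (r % p) * (n / p).choose (r / p) := by
    intro n r
    have := (ZMod.natCast_eq_natCast_iff _ _ _).2
      (Choose.choose_modEq_choose_mod_mul_choose_div_nat (n := n) (k := r) (p := p))
    rw [this]; push_cast; rfl
  induction k generalizing n r with
  | zero => simp [Nat.mod_one]
  | succ k ih =>
    rw [ih n r, lucas (n / p ^ k), ih (n % p ^ (k + 1)), pow_succ,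
      Nat.mod_mod_of_dvd _ (dvd_mul_right _ _), Nat.mod_mod_of_dvd _ (dvd_mul_right _ _),
      Nat.mod_mul_right_div_self, Nat.mod_mul_right_div_self, Nat.div_div_eq_div_mul,
      Nat.div_div_eq_div_mul, mul_assoc]

theorem choose_add_mul_cast (p : ℕ) [Fact p.Prime] (k : ℕ) {y r : ℕ} (t a : ℕ)
    (hy : y < p ^ k) (hr : r < p ^ k) :
    ((y + p ^ k * t).choose (r + p ^ k * a) : ZMod p) = y.choose r * t.choose a := by
  have hq : 0 < p ^ k := by omega
  rw [choose_cast_eq_mod_mul_div p k, Nat.add_mul_mod_self_left, Nat.add_mul_mod_self_left,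
    Nat.add_mul_div_left _ _ hq, Nat.add_mul_div_left _ _ hq, Nat.mod_eq_of_lt hy,
    Nat.mod_eq_of_lt hr, Nat.div_eq_of_lt hy, Nat.div_eq_of_lt hr, zero_add, zero_add]

theorem choose_mod_cast (p : ℕ) [Fact p.Prime] (k u : ℕ) {r : ℕ} (hr : r < p ^ k) :
    (u.choose r : ZMod p) = (u % p ^ k).choose r := by
  rw [choose_cast_eq_mod_mul_div p k, Nat.mod_eq_of_lt hr, Nat.div_eq_of_lt hr]
  simp

theorem inBinomialClosure_mod_iff {p : ℕ} [Fact p.Prime] {k D : ℕ} (hD : D < p ^ k) (S : Set ℕ)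
    (u : ℕ) : InBinomialClosure p D S u ↔
      InBinomialClosure p D ((fun v => v % p ^ k) '' S) (u % p ^ k) := by
  have h : ∀ (g : ℕ → ZMod p) (v : ℕ),
      ∑ r ∈ Finset.range (D + 1), g r * (v.choose r : ZMod p) =
      ∑ r ∈ Finset.range (D + 1), g r * ((v % p ^ k).choose r : ZMod p) := by
    intro g v
    refine Finset.sum_congr rfl fun r hr => ?_
    rw [choose_mod_cast p k v (by simp at hr; omega)]
  simp only [InBinomialClosure, Set.forall_mem_image, h _ u]
  exact forall_congr' fun g => imp_congr_left (forall₂_congr fun v _ => by rw [h g v])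

/-- Newton's forward difference formula. It is the reason why the coefficients below the top one are
arbitrary functions of the residue. -/
theorem exists_eq_sum_choose {R : Type*} [CommRing R] (N : ℕ) (f : ℕ → R) :
    ∃ g : ℕ → R, ∀ v < N, f v = ∑ r ∈ Finset.range N, g r * (v.choose r : R) := by
  refine ⟨fun r => (fwdDiff 1)^[r] f 0, fun v hv => ?_⟩
  have := shift_eq_sum_fwdDiff_iter 1 f v 0
  simp only [smul_eq_mul, mul_one, zero_add] at this
  rw [this]
  refine (Finset.sum_congr rfl fun r _ => by rw [nsmul_eq_mul, mul_comm]).trans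
    (Finset.sum_subset (Finset.range_mono (by omega)) fun r _ hr => ?_)
  rw [Nat.choose_eq_zero_of_lt (by simpa using hr)]
  simp

-- Newton's formula again; the `T`-th difference of a polynomial of degree at most `T` is `T!` times
-- its coefficient of degree `T`.
open Polynomial in
theorem exists_eval_natCast_eq_sum_choose {R : Type*} [CommRing R] {T : ℕ} (P : R[X])
    (hP : P.natDegree ≤ T) :
    ∃ b : ℕ → R, (∀ t : ℕ, P.eval (t : R) = ∑ a ∈ Finset.range (T + 1), b a * (t.choose a : R)) ∧
      b T = P.coeff T * (T.factorial : R) := by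
  refine ⟨fun a => (fwdDiff 1)^[a] P.eval 0, fun t => ?_, ?_⟩
  · have := shift_eq_sum_fwdDiff_iter 1 P.eval t 0
    simp only [nsmul_eq_mul, mul_one, zero_add] at this
    rw [this]
    have h1 : ∑ a ∈ Finset.range (t + 1), (t.choose a : R) * (fwdDiff 1)^[a] P.eval 0 =
        ∑ a ∈ Finset.range (max t T + 1), (fwdDiff 1)^[a] P.eval 0 * (t.choose a : R) := by
      refine (Finset.sum_congr rfl fun r _ => by rw [mul_comm]).trans
        (Finset.sum_subset (Finset.range_mono (by omega)) fun r _ hr => ?_)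
      rw [Nat.choose_eq_zero_of_lt (by simpa using hr)]
      simp
    rw [h1]
    symm
    refine Finset.sum_subset (Finset.range_mono (by omega)) fun r _ hr => ?_
    have hr' : P.natDegree < r := by simp at hr; omega
    simp [congrFun (fwdDiff_iter_eq_zero_of_degree_lt hr') 0]
  · rcases hP.eq_or_lt with h | h
    · subst h
      simp [fwdDiff_iter_degree_eq_factorial]
    · simp [fwdDiff_iter_eq_zero_of_degree_lt h, coeff_eq_zero_of_natDegree_lt h]

theorem factorial_cast_ne_zero {p a : ℕ} [Fact p.Prime] (ha : a < p) :
    (a.factorial : ZMod p) ≠ 0 := by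
  rw [Ne, ZMod.natCast_eq_zero_iff, (Fact.out : p.Prime).dvd_factorial]
  omega

-- For `a ≤ T < p` the factorial `a!` is invertible, so `choose a` is a falling factorial divided by
-- `a!`.
open Polynomial in
theorem exists_polynomial_eval_eq_sum_choose {p T : ℕ} [Fact p.Prime] (hT : T < p)
    (b : ℕ → ZMod p) :
    ∃ P : (ZMod p)[X], P.natDegree ≤ T ∧
      (∀ t : ℕ, P.eval (t : ZMod p) =
        ∑ a ∈ Finset.range (T + 1), b a * (t.choose a : ZMod p)) ∧
      P.coeff T = b T * (T.factorial : ZMod p)⁻¹ := by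
  refine ⟨∑ a ∈ Finset.range (T + 1),
    C (b a * (a.factorial : ZMod p)⁻¹) * descPochhammer (ZMod p) a, ?_, fun t => ?_, ?_⟩
  · refine natDegree_sum_le_of_forall_le _ _ fun a ha => ?_
    refine (natDegree_C_mul_le _ _).trans ?_
    rw [descPochhammer_natDegree]
    simpa [Nat.lt_succ_iff] using ha
  · rw [eval_finsetSum]
    refine Finset.sum_congr rfl fun a ha => ?_
    rw [eval_C_mul, descPochhammer_eval_eq_descFactorial, Nat.descFactorial_eq_factorial_mul_choose]
    have := factorial_cast_ne_zero (p := p) (a := a) (by simp at ha; omega)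
    push_cast
    field_simp
  · rw [finsetSum_coeff, Finset.sum_range_succ, Finset.sum_eq_zero, zero_add, coeff_C_mul]
    · have h1 := (monic_descPochhammer (ZMod p) T).coeff_natDegree
      rw [descPochhammer_natDegree] at h1
      rw [h1, mul_one]
    · intro a ha
      rw [coeff_C_mul, coeff_eq_zero_of_natDegree_lt, mul_zero]
      rw [descPochhammer_natDegree]
      simpa using ha

/-- All blocks are full except that of the top digit `D / q`, which stops at `D % q`. This
truncation is what constrains the top coefficients. -/
theorem sum_range_digits {M : Type*} [AddCommMonoid M] (F : ℕ → M) (q D : ℕ) :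
    ∑ r ∈ Finset.range (D + 1), F r =
      ∑ a ∈ Finset.range (D / q + 1), ∑ r ∈ Finset.range (if a < D / q then q else D % q + 1),
        F (r + q * a) := by
  have h1 : ∀ T, ∑ r ∈ Finset.range (q * T), F r =
      ∑ a ∈ Finset.range T, ∑ r ∈ Finset.range q, F (r + q * a) := by
    intro T
    induction T with
    | zero => simp
    | succ T ih =>
      rw [mul_add, mul_one, Finset.sum_range_add, ih, Finset.sum_range_succ]
      simp only [add_comm]
  have h2 : D + 1 = q * (D / q) + (D % q + 1) := by
    have := Nat.div_add_mod D q
    omega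
  have h3 : ∑ a ∈ Finset.range (D / q),
      ∑ r ∈ Finset.range (if a < D / q then q else D % q + 1), F (r + q * a) =
      ∑ a ∈ Finset.range (D / q), ∑ r ∈ Finset.range q, F (r + q * a) :=
    Finset.sum_congr rfl fun a ha => by rw [if_pos (by simpa using ha)]
  rw [h2, Finset.sum_range_succ (n := D / q), h3, if_neg (lt_irrefl _), ← h1, Finset.sum_range_add]
  simp only [add_comm]

theorem sum_choose_digits {p : ℕ} [Fact p.Prime] (k D : ℕ) (g : ℕ → ZMod p) {y : ℕ}
    (hy : y < p ^ k) (t : ℕ) :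
    ∑ r ∈ Finset.range (D + 1), g r * ((y + p ^ k * t).choose r : ZMod p) =
      ∑ a ∈ Finset.range (D / p ^ k + 1),
        (∑ r ∈ Finset.range (if a < D / p ^ k then p ^ k else D % p ^ k + 1),
          g (r + p ^ k * a) * (y.choose r : ZMod p)) * (t.choose a : ZMod p) := by
  have hq : 0 < p ^ k := by omega
  rw [sum_range_digits _ (p ^ k)]
  refine Finset.sum_congr rfl fun a _ => ?_
  rw [Finset.sum_mul]
  refine Finset.sum_congr rfl fun r hr => ?_
  have hr' : r < p ^ k := by
    have := Nat.mod_lt D hq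
    simp only [Finset.mem_range] at hr
    split_ifs at hr <;> omega
  rw [choose_add_mul_cast p k t a hy hr', mul_assoc]

open Polynomial in
theorem exists_fiber_polynomials {p : ℕ} [Fact p.Prime] {k D : ℕ} (hD : D < p ^ (k + 1))
    (g : ℕ → ZMod p) :
    ∃ (P : ℕ → (ZMod p)[X]) (g' : ℕ → ZMod p), (∀ y, (P y).natDegree ≤ D / p ^ k) ∧
      (∀ y < p ^ k, ∀ t : ℕ, (P y).eval (t : ZMod p) =
        ∑ r ∈ Finset.range (D + 1), g r * ((y + p ^ k * t).choose r : ZMod p)) ∧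
      ∀ y, (P y).coeff (D / p ^ k) =
        ∑ r ∈ Finset.range (D % p ^ k + 1), g' r * (y.choose r : ZMod p) := by
  have hT : D / p ^ k < p := Nat.div_lt_of_lt_mul (by rwa [pow_succ] at hD)
  choose P h1 h2 h3 using fun y : ℕ => exists_polynomial_eval_eq_sum_choose hT (fun a =>
    ∑ r ∈ Finset.range (if a < D / p ^ k then p ^ k else D % p ^ k + 1),
      g (r + p ^ k * a) * (y.choose r : ZMod p))
  refine ⟨P, fun r => g (r + p ^ k * (D / p ^ k)) * ((D / p ^ k).factorial : ZMod p)⁻¹, h1,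
    fun y hy t => ?_, fun y => ?_⟩
  · rw [h2, sum_choose_digits k D g hy]
  · rw [h3, Finset.sum_mul]
    simp only [lt_irrefl, if_false]
    exact Finset.sum_congr rfl fun r _ => by ring

-- Converse of `exists_fiber_polynomials`: fibre polynomials may be chosen freely as long as their
-- top coefficients form a binomial combination of degree `D % p ^ k`.
open Polynomial in
theorem exists_sum_choose_eq_eval {p : ℕ} [Fact p.Prime] {k D : ℕ}
    (P : ℕ → (ZMod p)[X]) (g' : ℕ → ZMod p) (hP : ∀ y, (P y).natDegree ≤ D / p ^ k)
    (hg' : ∀ y < p ^ k, (P y).coeff (D / p ^ k) =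
      ∑ r ∈ Finset.range (D % p ^ k + 1), g' r * (y.choose r : ZMod p)) :
    ∃ g : ℕ → ZMod p, ∀ y < p ^ k, ∀ t : ℕ,
      ∑ r ∈ Finset.range (D + 1), g r * ((y + p ^ k * t).choose r : ZMod p) =
        (P y).eval (t : ZMod p) := by
  choose b hb hbT using fun y => exists_eval_natCast_eq_sum_choose (P y) (hP y)
  have h1 : ∀ a, ∃ h : ℕ → ZMod p, a ≤ D / p ^ k → ∀ y < p ^ k, b y a =
      ∑ r ∈ Finset.range (if a < D / p ^ k then p ^ k else D % p ^ k + 1),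
        h r * (y.choose r : ZMod p) := by
    intro a
    by_cases ha : a < D / p ^ k
    · obtain ⟨h, hh⟩ := exists_eq_sum_choose (p ^ k) (fun y => b y a)
      exact ⟨h, fun _ y hy => by rw [if_pos ha]; exact hh y hy⟩
    · refine ⟨fun r => g' r * ((D / p ^ k).factorial : ZMod p), fun ha' y hy => ?_⟩
      obtain rfl : a = D / p ^ k := by omega
      rw [hbT, hg' y hy, if_neg ha, Finset.sum_mul]
      exact Finset.sum_congr rfl fun r _ => by ring
  choose h hh using h1
  refine ⟨fun r => h (r / p ^ k) (r % p ^ k), fun y hy t => ?_⟩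
  have hq : 0 < p ^ k := by omega
  rw [sum_choose_digits k D _ hy, hb]
  refine Finset.sum_congr rfl fun a ha => ?_
  rw [hh a (by simpa [Nat.lt_succ_iff] using ha) y hy]
  congr 1
  refine Finset.sum_congr rfl fun r hr => ?_
  have hr' : r < p ^ k := by
    have := Nat.mod_lt D hq
    simp only [Finset.mem_range] at hr
    split_ifs at hr <;> omega
  rw [Nat.add_mul_div_left _ _ hq, Nat.add_mul_mod_self_left, Nat.mod_eq_of_lt hr',
    Nat.div_eq_of_lt hr', zero_add]

/-- The part of a fibre on which `a` does not vanish. -/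
def fiberSupport (p q : ℕ) (a : ℕ → ℕ) (y : ℕ) : Finset ℕ :=
  (Finset.range p).filter fun t => a (y + q * t) ≠ 0

theorem card_fiberSupport {p q : ℕ} {a : ℕ → ℕ} (ha : ∀ v, a v ≤ 1) (y : ℕ) :
    (fiberSupport p q a y).card = fiberCount p q a y := by
  rw [fiberSupport, Finset.card_filter, fiberCount]
  refine Finset.sum_congr rfl fun t _ => ?_
  have := ha (y + q * t)
  split_ifs <;> omega

theorem injOn_natCast_zmod {p : ℕ} {s : Set ℕ} (hs : ∀ t ∈ s, t < p) :
    Set.InjOn (fun t : ℕ => (t : ZMod p)) s := by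
  intro t ht t' ht' h
  have := (ZMod.natCast_eq_natCast_iff' _ _ _).1 h
  rwa [Nat.mod_eq_of_lt (hs t ht), Nat.mod_eq_of_lt (hs t' ht')] at this

theorem lt_of_mem_fiberSupport {p q : ℕ} {a : ℕ → ℕ} {y t : ℕ} (h : t ∈ fiberSupport p q a y) :
    t < p := by
  simpa using (Finset.mem_filter.1 h).1

open Polynomial in
/-- The monic polynomial of degree `T` that vanishes on the given part of a fibre. -/
noncomputable def fiberPolynomial (p T : ℕ) (Z : Finset ℕ) : (ZMod p)[X] :=
  X ^ (T - Z.card) * ∏ z ∈ Z, (X - C (z : ZMod p))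

section

open Polynomial

theorem natDegree_fiberPolynomial {p : ℕ} [Fact p.Prime] {T : ℕ} {Z : Finset ℕ} (h : Z.card ≤ T) :
    (fiberPolynomial p T Z).natDegree = T := by
  rw [fiberPolynomial, (monic_X_pow _).natDegree_mul (monic_prod_X_sub_C _ _), natDegree_X_pow,
    natDegree_finsetProd_X_sub_C_eq_card]
  omega

theorem coeff_fiberPolynomial {p : ℕ} [Fact p.Prime] {T : ℕ} {Z : Finset ℕ} (h : Z.card ≤ T) :
    (fiberPolynomial p T Z).coeff T = 1 := by
  have : (fiberPolynomial p T Z).Monic := (monic_X_pow _).mul (monic_prod_X_sub_C _ _)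
  have h1 := this.coeff_natDegree
  rwa [natDegree_fiberPolynomial h] at h1

theorem eval_fiberPolynomial_eq_zero {p T : ℕ} {Z : Finset ℕ} {t : ℕ} (ht : t ∈ Z) :
    (fiberPolynomial p T Z).eval (t : ZMod p) = 0 := by
  rw [fiberPolynomial, eval_mul, eval_prod, Finset.prod_eq_zero ht, mul_zero]
  simp

/-- When `T = |Z|` no power of `X` is used as padding, so there are no further roots. -/
theorem eval_fiberPolynomial_ne_zero {p : ℕ} [Fact p.Prime] {T : ℕ} {Z : Finset ℕ}
    (hZ : ∀ z ∈ Z, z < p) (hT : T = Z.card) {t : ℕ} (htp : t < p) (ht : t ∉ Z) :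
    (fiberPolynomial p T Z).eval (t : ZMod p) ≠ 0 := by
  rw [fiberPolynomial, hT, Nat.sub_self, pow_zero, one_mul, eval_prod, Finset.prod_ne_zero_iff]
  intro z hz h
  have h1 : (t : ZMod p) = z := by simpa [sub_eq_zero] using h
  have h2 : t = z := injOn_natCast_zmod (s := {v | v < p}) (fun _ h => h) htp (hZ z hz) h1
  exact ht (h2 ▸ hz)

theorem eq_zero_of_fiberSupport {p : ℕ} [Fact p.Prime] {q T : ℕ} {a : ℕ → ℕ} (ha : ∀ v, a v ≤ 1)
    {y : ℕ} {P : (ZMod p)[X]} (hdeg : P.natDegree ≤ T)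
    (hP : ∀ t ∈ fiberSupport p q a y, P.eval (t : ZMod p) = 0)
    (hT : T < fiberCount p q a y ∨ (T ≤ fiberCount p q a y ∧ P.coeff T = 0)) : P = 0 := by
  have hinj : Set.InjOn (fun t : ℕ => (t : ZMod p)) (fiberSupport p q a y) :=
    injOn_natCast_zmod fun t ht => lt_of_mem_fiberSupport (Finset.mem_coe.1 ht)
  refine eq_zero_of_degree_lt_of_eval_index_eq_zero _ hinj ?_ hP
  rw [card_fiberSupport ha]
  rcases hT with hT | ⟨hT, h0⟩
  · exact degree_le_natDegree.trans_lt (by exact_mod_cast hdeg.trans_lt hT)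
  · refine lt_of_lt_of_le ?_ (show ((T : ℕ) : WithBot ℕ) ≤ _ by exact_mod_cast hT)
    rw [degree_lt_iff_coeff_zero]
    intro m hm
    rcases hm.eq_or_lt with rfl | hm
    · exact h0
    · exact coeff_eq_zero_of_natDegree_lt (hdeg.trans_lt hm)

theorem heavyResidues_le_one {p q T : ℕ} {a : ℕ → ℕ} (y : ℕ) : heavyResidues p q T a y ≤ 1 := by
  rw [heavyResidues]; split_ifs <;> simp

theorem heavyResidues_ne_zero_iff {p q T : ℕ} {a : ℕ → ℕ} {y : ℕ} :
    heavyResidues p q T a y ≠ 0 ↔ T < fiberCount p q a y := by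
  rw [heavyResidues]; split_ifs with h <;> simp [h]

/-- Let `N` be the number of points of the set in the fibre of `u`. If `N < T`, a polynomial of
degree `N` on this fibre, and zero on the others, separates `u`. If `N > T`, there are too many
roots and the fibre polynomial is zero. If `N = T`, it is a multiple of the product of the root
factors, hence zero iff its top coefficient is. Top coefficients must vanish at the heavy residues
and can be prescribed at the light ones by padding, so the question passes to the closure of the
heavy residues. -/
theorem inBinomialClosure_succ_iff {p : ℕ} [Fact p.Prime] {k D u : ℕ} {a : ℕ → ℕ}
    (ha : ∀ v, a v ≤ 1) (hD : D < p ^ (k + 1)) (hu : u < p ^ (k + 1)) (hau : a u = 0) :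
    InBinomialClosure p D {v | v < p ^ (k + 1) ∧ a v ≠ 0} u ↔
      D / p ^ k ≤ fiberCount p (p ^ k) a (u % p ^ k) ∧
        InBinomialClosure p (D % p ^ k)
          {v | v < p ^ k ∧ heavyResidues p (p ^ k) (D / p ^ k) a v ≠ 0} (u % p ^ k) := by
  have hp : p.Prime := Fact.out
  have hq : 0 < p ^ k := pow_pos hp.pos k
  have hy : u % p ^ k < p ^ k := Nat.mod_lt _ hq
  have ht : u / p ^ k < p := Nat.div_lt_of_lt_mul (by rwa [pow_succ] at hu)
  have huyt : u = u % p ^ k + p ^ k * (u / p ^ k) := (Nat.mod_add_div _ _).symm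
  have htZ : u / p ^ k ∉ fiberSupport p (p ^ k) a (u % p ^ k) := by
    simp [fiberSupport, ← huyt, hau]
  have hlt : ∀ y < p ^ k, ∀ t < p, y + p ^ k * t < p ^ (k + 1) := by
    intro y hy t ht
    rw [pow_succ]
    nlinarith [Nat.mul_le_mul_left (p ^ k) (Nat.succ_le_of_lt ht)]
  have hdecomp : ∀ v < p ^ (k + 1), a v ≠ 0 →
      v / p ^ k ∈ fiberSupport p (p ^ k) a (v % p ^ k) := by
    intro v hv hav
    refine Finset.mem_filter.2 ⟨?_, by rwa [Nat.mod_add_div]⟩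
    exact Finset.mem_range.2 (Nat.div_lt_of_lt_mul (by rwa [pow_succ] at hv))
  set y := u % p ^ k with hydef
  set t := u / p ^ k
  set T := D / p ^ k
  -- a violating family of fibre polynomials shows that `u` is not in the closure
  have escape : ∀ (P : ℕ → (ZMod p)[X]) (g' : ℕ → ZMod p), (∀ y, (P y).natDegree ≤ T) →
      (∀ y < p ^ k, (P y).coeff T =
        ∑ r ∈ Finset.range (D % p ^ k + 1), g' r * (y.choose r : ZMod p)) →
      (∀ y < p ^ k, ∀ z ∈ fiberSupport p (p ^ k) a y, (P y).eval (z : ZMod p) = 0) →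
      InBinomialClosure p D {v | v < p ^ (k + 1) ∧ a v ≠ 0} u → (P y).eval (t : ZMod p) = 0 := by
    intro P g' hdeg hcoeff hzero hin
    obtain ⟨g, hg⟩ := exists_sum_choose_eq_eval P g' hdeg hcoeff
    rw [← hg y hy t, ← huyt]
    refine hin g fun v hv => ?_
    have := hg (v % p ^ k) (Nat.mod_lt _ hq) (v / p ^ k)
    rw [Nat.mod_add_div] at this
    rw [this]
    exact hzero _ (Nat.mod_lt _ hq) _ (hdecomp v hv.1 hv.2)
  constructor
  · intro hin
    have hTle : T ≤ fiberCount p (p ^ k) a y := by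
      by_contra hlt'
      push Not at hlt'
      rw [← card_fiberSupport ha] at hlt'
      -- The degree is below `T`, so all top coefficients are zero and `g' = 0` serves.
      refine absurd (escape (fun y' => if y' = y then
          fiberPolynomial p (fiberSupport p (p ^ k) a y).card (fiberSupport p (p ^ k) a y) else 0)
        0 ?_ ?_ ?_ hin) ?_
      · intro y'
        split_ifs
        · rw [natDegree_fiberPolynomial le_rfl]; exact hlt'.le
        · simp
      · intro y' _
        split_ifs
        · rw [coeff_eq_zero_of_natDegree_lt]
          · simp
          · rwa [natDegree_fiberPolynomial le_rfl]
        · simp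
      · intro y' _ z hz
        split_ifs with h
        · subst h; exact eval_fiberPolynomial_eq_zero hz
        · simp
      · rw [if_pos rfl]
        exact eval_fiberPolynomial_ne_zero (fun z hz => lt_of_mem_fiberSupport hz) rfl ht htZ
    · refine ⟨hTle, fun g' hg' => ?_⟩
      by_contra hne
      set G : ℕ → ZMod p := fun y =>
        ∑ r ∈ Finset.range (D % p ^ k + 1), g' r * (y.choose r : ZMod p) with hG
      have hGz : ∀ v < p ^ k, T < (fiberSupport p (p ^ k) a v).card → G v = 0 := by
        intro v hv hvT
        rw [card_fiberSupport ha] at hvT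
        exact hg' v ⟨hv, heavyResidues_ne_zero_iff.2 hvT⟩
      have hyT : (fiberSupport p (p ^ k) a y).card ≤ T := by
        by_contra h
        exact hne (hGz y hy (by omega))
      -- On light fibres `G` is realised as top coefficient; on heavy ones `G` vanishes and so does
      -- the polynomial.
      have := escape (fun y' => if (fiberSupport p (p ^ k) a y').card ≤ T then
        C (G y') * fiberPolynomial p T (fiberSupport p (p ^ k) a y') else 0) g' ?_ ?_ ?_ hin
      · rw [if_pos hyT, eval_C_mul] at this
        rcases mul_eq_zero.1 this with h | h
        · exact hne h
        rw [← card_fiberSupport ha] at hTle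
        exact eval_fiberPolynomial_ne_zero (fun z hz => lt_of_mem_fiberSupport hz)
          (le_antisymm hTle hyT) ht htZ h
      · intro y'
        split_ifs with h
        · exact (natDegree_C_mul_le _ _).trans (natDegree_fiberPolynomial h).le
        · simp
      · intro y' hy'
        split_ifs with h
        · rw [coeff_C_mul, coeff_fiberPolynomial h, mul_one]
        · rw [coeff_zero, ← hGz y' hy' (by omega)]
      · intro y' _ z hz
        split_ifs with h
        · rw [eval_C_mul, eval_fiberPolynomial_eq_zero hz, mul_zero]
        · simp
  · rintro ⟨hT, hin⟩ g hg
    obtain ⟨P, g', hdeg, heval, hcoeff⟩ := exists_fiber_polynomials hD g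
    have hzero : ∀ y' < p ^ k, ∀ z ∈ fiberSupport p (p ^ k) a y', (P y').eval (z : ZMod p) = 0 := by
      intro y' hy' z hz
      rw [heval y' hy' z]
      exact hg _ ⟨hlt y' hy' z (lt_of_mem_fiberSupport hz), (Finset.mem_filter.1 hz).2⟩
    have h0 : (P y).coeff T = 0 := by
      rw [hcoeff]
      refine hin g' fun v hv => ?_
      rw [← hcoeff, eq_zero_of_fiberSupport ha (hdeg v) (hzero v hv.1)
        (Or.inl (heavyResidues_ne_zero_iff.1 hv.2)), coeff_zero]
    have h1 : P y = 0 := eq_zero_of_fiberSupport ha (hdeg y) (hzero y hy) (Or.inr ⟨hT, h0⟩)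
    have h2 := heval y hy t
    rw [← huyt, h1, eval_zero] at h2
    exact h2.symm

end

theorem inBinomialClosure_iff_inDigitClosure {p : ℕ} [Fact p.Prime] (k D u : ℕ) (a : ℕ → ℕ)
    (ha : ∀ v, a v ≤ 1) (hD : D < p ^ k) (hu : u < p ^ k) :
    InBinomialClosure p D {v | v < p ^ k ∧ a v ≠ 0} u ↔ InDigitClosure p k a D u := by
  induction k generalizing D u a with
  | zero =>
    obtain rfl : D = 0 := by simpa using hD
    obtain rfl : u = 0 := by simpa using hu
    simp only [InDigitClosure, InBinomialClosure]
    refine ⟨fun h h0 => ?_, fun h g hg => hg 0 ⟨by simp, h⟩⟩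
    have := h (fun _ => 1) ?_
    · simp at this
    · rintro v ⟨hv, hav⟩
      obtain rfl : v = 0 := by simpa using hv
      exact absurd h0 hav
  | succ k ih =>
    by_cases hau : a u = 0
    · have hq : 0 < p ^ k := pow_pos (Fact.out : p.Prime).pos k
      rw [inBinomialClosure_succ_iff ha hD hu hau, InDigitClosure,
        ih _ _ _ heavyResidues_le_one (Nat.mod_lt _ hq) (Nat.mod_lt _ hq)]
      simp [hau]
    · simp only [InDigitClosure, ne_eq, hau, not_false_eq_true, true_or, iff_true]
      exact fun g hg => hg u ⟨hu, hau⟩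

/-! ### Time-bounded correctness of programs and the basic routines. -/

namespace Ram

/-- Sequential composition of programs. -/
infixr:65 " ;; " => Prog.seq

theorem reg_setReg (s : Store) (x v y : ℕ) :
    (s.setReg x v).reg y = if y = x then v else s.reg y := by
  simp [Store.setReg, Function.update_apply]

theorem arr_setReg (s : Store) (x v : ℕ) : (s.setReg x v).arr = s.arr := rfl

theorem reg_setArr (s : Store) (a i v : ℕ) : (s.setArr a i v).reg = s.reg := rfl

theorem arr_setArr (s : Store) (a i v b j : ℕ) :
    (s.setArr a i v).arr b j = if b = a ∧ j = i then v else s.arr b j := by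
  by_cases h : b = a
  · subst h; simp [Store.setArr, Function.update_apply]
  · simp [Store.setArr, h]

theorem arr_setArr_of_ne (s : Store) {a b : ℕ} (i v : ℕ) (h : b ≠ a) :
    (s.setArr a i v).arr b = s.arr b := by
  simp [Store.setArr, h]

/-- The program `P`, started in `s`, halts after at most `T` steps in a state that satisfies `Q`. -/
def Runs (P : Prog) (T : ℕ) (s : Store) (Q : Store → Prop) : Prop :=
  ∃ t ≤ T, ∃ s', Exec P s t s' ∧ Q s'

/-- The two states agree on the registers below `r` and on the arrays below `b`. -/
structure Same (r b : ℕ) (s s' : Store) : Prop where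
  reg : ∀ x < r, s'.reg x = s.reg x
  arr : ∀ a < b, s'.arr a = s.arr a

namespace Same

variable {r b : ℕ} {s s' s'' : Store}

theorem refl (r b : ℕ) (s : Store) : Same r b s s := ⟨fun _ _ => rfl, fun _ _ => rfl⟩

theorem trans (h : Same r b s s') (h' : Same r b s' s'') : Same r b s s'' :=
  ⟨fun x hx => (h'.reg x hx).trans (h.reg x hx), fun a ha => (h'.arr a ha).trans (h.arr a ha)⟩

theorem mono {r' b' : ℕ} (h : Same r b s s') (hr : r' ≤ r) (hb : b' ≤ b) : Same r' b' s s' :=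
  ⟨fun x hx => h.reg x (by omega), fun a ha => h.arr a (by omega)⟩

theorem setReg (h : Same r b s s') {x : ℕ} (v : ℕ) (hx : r ≤ x) : Same r b s (s'.setReg x v) :=
  ⟨fun y hy => by rw [reg_setReg, if_neg (by omega), h.reg y hy], h.arr⟩

theorem setArr (h : Same r b s s') {a : ℕ} (i v : ℕ) (ha : b ≤ a) :
    Same r b s (s'.setArr a i v) :=
  ⟨h.reg, fun c hc => by rw [arr_setArr_of_ne _ _ _ (by omega), h.arr c hc]⟩

end Same

namespace Runs

variable {P R : Prog} {T T' x y z a c : ℕ} {s : Store} {Q Q' : Store → Prop}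

theorem mono (h : Runs P T s Q) (hT : T ≤ T') (hQ : ∀ s', Q s' → Q' s') : Runs P T' s Q' := by
  obtain ⟨t, ht, s', he, hq⟩ := h
  exact ⟨t, ht.trans hT, s', he, hQ s' hq⟩

theorem seq (h : Runs P T s Q') (h' : ∀ s', Q' s' → Runs R T' s' Q) :
    Runs (P ;; R) (T + T') s Q := by
  obtain ⟨t, ht, s', he, hq⟩ := h
  obtain ⟨t', ht', s'', he', hq'⟩ := h' s' hq
  exact ⟨t + t', add_le_add ht ht', s'', .seq he he', hq'⟩

theorem const (h : Q (s.setReg x c)) : Runs (.const x c) 1 s Q := ⟨1, le_rfl, _, .const .., h⟩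

theorem add (h : Q (s.setReg x (s.reg y + s.reg z))) : Runs (.add x y z) 1 s Q :=
  ⟨1, le_rfl, _, .add .., h⟩

theorem sub (h : Q (s.setReg x (s.reg y - s.reg z))) : Runs (.sub x y z) 1 s Q :=
  ⟨1, le_rfl, _, .sub .., h⟩

theorem load (h : Q (s.setReg x (s.arr a (s.reg y)))) : Runs (.load x a y) 1 s Q :=
  ⟨1, le_rfl, _, .load .., h⟩

theorem store (h : Q (s.setArr a (s.reg x) (s.reg y))) : Runs (.store a x y) 1 s Q :=
  ⟨1, le_rfl, _, .store .., h⟩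

theorem const_seq (h : Runs R T (s.setReg x c) Q) : Runs (.const x c ;; R) (1 + T) s Q :=
  seq (Q' := fun s' => s' = s.setReg x c) (const rfl) fun _ hs => hs ▸ h

theorem add_seq (h : Runs R T (s.setReg x (s.reg y + s.reg z)) Q) :
    Runs (.add x y z ;; R) (1 + T) s Q :=
  seq (Q' := fun s' => s' = s.setReg x (s.reg y + s.reg z)) (add rfl) fun _ hs => hs ▸ h

theorem sub_seq (h : Runs R T (s.setReg x (s.reg y - s.reg z)) Q) :
    Runs (.sub x y z ;; R) (1 + T) s Q :=
  seq (Q' := fun s' => s' = s.setReg x (s.reg y - s.reg z)) (sub rfl) fun _ hs => hs ▸ h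

theorem load_seq (h : Runs R T (s.setReg x (s.arr a (s.reg y))) Q) :
    Runs (.load x a y ;; R) (1 + T) s Q :=
  seq (Q' := fun s' => s' = s.setReg x (s.arr a (s.reg y))) (load rfl) fun _ hs => hs ▸ h

theorem store_seq (h : Runs R T (s.setArr a (s.reg x) (s.reg y)) Q) :
    Runs (.store a x y ;; R) (1 + T) s Q :=
  seq (Q' := fun s' => s' = s.setArr a (s.reg x) (s.reg y)) (store rfl) fun _ hs => hs ▸ h

theorem ite (h : s.reg x ≠ 0 → Runs P T s Q) (h' : s.reg x = 0 → Runs R T s Q) :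
    Runs (.ite x P R) (T + 1) s Q := by
  by_cases hx : s.reg x = 0
  · obtain ⟨t, ht, s', he, hq⟩ := h' hx
    exact ⟨t + 1, by omega, s', .ite_false hx he, hq⟩
  · obtain ⟨t, ht, s', he, hq⟩ := h hx
    exact ⟨t + 1, by omega, s', .ite_true hx he, hq⟩

theorem while_false (hx : s.reg x = 0) (h : Q s) : Runs (.while x P) 1 s Q :=
  ⟨1, le_rfl, s, .while_false hx, h⟩

theorem while_true (hx : s.reg x ≠ 0)
    (h : Runs P T s fun s' => Runs (.while x P) T' s' Q) :
    Runs (.while x P) (T + T' + 1) s Q := by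
  obtain ⟨t, ht, s', he, t', ht', s'', he', hq⟩ := h
  exact ⟨t + t' + 1, by omega, s'', .while_true hx he he', hq⟩

end Runs

/-- For `x` from `0` to `N - 1`, do `P`.  The register `3` has to hold the number `1`; the register
`c` is used as a scratch register. -/
def forLoop (x c N : ℕ) (P : Prog) : Prog :=
  .const x 0 ;; .sub c N x ;; .while c (P ;; .add x x 3 ;; .sub c N x)

/-- The invariant refers to the state after the counter and the scratch register are updated. Each
pass costs three steps besides the body: increment, difference, test; the last `3` is two initial
assignments and the final test. -/
theorem Runs.forLoop {x c N M T : ℕ} {P : Prog} {s : Store} (Inv : ℕ → Store → Prop)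
    (hN : s.reg N = M) (hxN : N ≠ x) (hxc : x ≠ c)
    (h0 : Inv 0 ((s.setReg x 0).setReg c M))
    (hP : ∀ k < M, ∀ s', Inv k s' → s'.reg x = k → Runs P T s' fun s'' =>
      s''.reg 3 = 1 ∧ s''.reg x = k ∧ s''.reg N = M ∧
        Inv (k + 1) ((s''.setReg x (k + 1)).setReg c (M - (k + 1)))) :
    Runs (forLoop x c N P) (M * (T + 3) + 3) s (Inv M) := by
  have loop : ∀ m k s', m + k = M → Inv k s' → s'.reg x = k → s'.reg c = m →
      Runs (.while c (P ;; .add x x 3 ;; .sub c N x)) (m * (T + 3) + 1) s' (Inv M) := by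
    intro m
    induction m with
    | zero =>
      intro k s' hk hinv hx hc
      obtain rfl : k = M := by omega
      exact (Runs.while_false hc hinv).mono (by omega) fun _ h => h
    | succ m ih =>
      intro k s' hk hinv hx hc
      refine Runs.mono (Runs.while_true (T := T + (1 + 1)) (T' := m * (T + 3) + 1) (by omega) ?_)
        (by ring_nf; omega) fun _ h => h
      refine Runs.seq (hP k (by omega) s' hinv hx) fun s'' ⟨h3, hx', hN', hinv'⟩ => ?_
      refine Runs.add_seq (Runs.sub ?_)
      simp only [reg_setReg, hxN, if_false, if_true, hx', h3, hN']
      refine ih (k + 1) _ (by omega) hinv' ?_ ?_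
      · simp [reg_setReg, hxc]
      · simp [reg_setReg]; omega
  refine Runs.mono (Runs.const_seq (Runs.sub_seq ?_)) (by omega : 1 + (1 + (M * (T + 3) + 1)) ≤ _)
    fun _ h => h
  simp only [reg_setReg, hxN, if_false, if_true, hN, Nat.sub_zero]
  exact loop M 0 _ rfl h0 (by simp [reg_setReg, hxc]) (by simp [reg_setReg])

/-- Division with remainder of the register `60` by the register `61`: the remainder is put into
the register `60`, the quotient into the register `62`. -/
def divMod : Prog :=
  .const 62 0 ;; .add 64 60 3 ;; .sub 63 64 61 ;;
    .while 63 (.sub 60 60 61 ;; .add 62 62 3 ;; .add 64 60 3 ;; .sub 63 64 61)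

/-- Repeated subtraction. The loop register holds the truncated difference `x + 1 - q`, nonzero
exactly when `q ≤ x`; every pass costs five steps and lowers `x` by at least one. -/
theorem runs_divMod {s : Store} {x q : ℕ} (h3 : s.reg 3 = 1) (hx : s.reg 60 = x)
    (hq : s.reg 61 = q) (hq0 : 0 < q) :
    Runs divMod (5 * x + 4) s fun s' => (∀ r < 60, s'.reg r = s.reg r) ∧ s'.arr = s.arr ∧
      s'.reg 60 = x % q ∧ s'.reg 62 = x / q := by
  have loop : ∀ x s', s'.reg 3 = 1 → s'.reg 60 = x → s'.reg 61 = q → s'.reg 63 = x + 1 - q →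
      Runs (.while 63 (.sub 60 60 61 ;; .add 62 62 3 ;; .add 64 60 3 ;; .sub 63 64 61))
        (5 * x + 1) s' fun s'' => (∀ r < 60, s''.reg r = s'.reg r) ∧ s''.arr = s'.arr ∧
          s''.reg 60 = x % q ∧ s''.reg 62 = s'.reg 62 + x / q := by
    intro x
    induction x using Nat.strong_induction_on with
    | _ x ih =>
      intro s' h3 hx hq h63
      by_cases hlt : x < q
      · refine (Runs.while_false (by omega) ?_).mono (by omega) fun _ h => h
        exact ⟨fun _ _ => rfl, rfl, by rw [hx, Nat.mod_eq_of_lt hlt], by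
          rw [Nat.div_eq_of_lt hlt, add_zero]⟩
      · refine Runs.mono (Runs.while_true (T' := 5 * (x - q) + 1) (by omega)
          (Runs.sub_seq (Runs.add_seq (Runs.add_seq (Runs.sub ?_))))) (by omega) fun _ h => h
        refine (ih (x - q) (by omega) _ ?_ ?_ ?_ ?_).mono le_rfl ?_
        · simp [reg_setReg, h3]
        · simp [reg_setReg, hx, hq]
        · simp [reg_setReg, hq]
        · simp [reg_setReg, hx, hq, h3]
        · rintro s'' ⟨h1, h2, h4, h5⟩
          refine ⟨fun r hr => ?_, h2, ?_, ?_⟩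
          · rw [h1 r hr]
            simp only [reg_setReg]
            repeat rw [if_neg (by omega)]
          · rw [h4]; exact (Nat.mod_eq_sub_mod (by omega)).symm
          · rw [h5, Nat.div_eq_sub_div hq0 (show q ≤ x by omega)]
            simp only [reg_setReg, h3]
            norm_num
            omega
  refine Runs.mono (Runs.const_seq (Runs.add_seq (Runs.sub_seq (loop x _ ?_ ?_ ?_ ?_)))) (by omega) ?_
  · simp [reg_setReg, h3]
  · simp [reg_setReg, hx]
  · simp [reg_setReg, hq]
  · simp [reg_setReg, hx, h3, hq]
  · rintro s'' ⟨h1, h2, h4, h5⟩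
    refine ⟨fun r hr => ?_, h2, h4, by rw [h5]; simp [reg_setReg]⟩
    rw [h1 r hr]
    simp only [reg_setReg]
    repeat rw [if_neg (by omega)]

/-- If the register `23` is nonzero and the cell of the array `2` with the index in the register
`22` is nonzero, put `1` into the register `20`. -/
def check : Prog :=
  .ite 23 (.load 29 2 22 ;; .ite 29 (.const 20 1) (.const 29 0)) (.const 29 0)

theorem runs_check (s : Store) : Runs check 4 s fun s' => Same 20 2 s s' ∧
    (∀ r, r ≠ 20 → r ≠ 29 → s'.reg r = s.reg r) ∧ s'.arr = s.arr ∧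
      (s'.reg 20 ≠ 0 ↔ s.reg 20 ≠ 0 ∨ (s.reg 23 ≠ 0 ∧ s.arr 2 (s.reg 22) ≠ 0)) := by
  refine Runs.mono (T := 1 + (1 + 1) + 1) (Runs.ite (fun h => Runs.load_seq
    (Runs.ite (fun h' => Runs.const ?_) (fun h' => Runs.const ?_)))
    (fun h => Runs.mono (Runs.const ?_) (by omega) fun _ h => h)) le_rfl fun _ h => h
  · simp only [reg_setReg, if_true] at h'
    refine ⟨(((Same.refl _ _ _).setReg _ (by omega)).setReg _ (by omega)), fun r hr hr' => ?_, rfl, ?_⟩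
    · simp [reg_setReg, hr, hr']
    · simp [reg_setReg, h, h']
  · simp only [reg_setReg, if_true] at h'
    refine ⟨(((Same.refl _ _ _).setReg _ (by omega)).setReg _ (by omega)), fun r hr hr' => ?_, rfl, ?_⟩
    · simp [reg_setReg, hr']
    · simp [reg_setReg, h']
  · refine ⟨(Same.refl _ _ _).setReg _ (by omega), fun r hr hr' => ?_, rfl, ?_⟩
    · simp [reg_setReg, hr']
    · simp [reg_setReg, h]

/-- Put the fibre count of the register `40` into the register `44`. -/
def countFiber : Prog :=
  .const 44 0 ;; .add 45 40 7 ;; forLoop 42 43 0 (.load 46 2 45 ;; .add 44 44 46 ;; .add 45 45 26)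

theorem runs_countFiber {s : Store} {p q : ℕ} (h0 : s.reg 0 = p) (h3 : s.reg 3 = 1)
    (h7 : s.reg 7 = 0) (h26 : s.reg 26 = q) :
    Runs countFiber (6 * p + 5) s fun s' => Same 42 10 s s' ∧
      s'.reg 44 = fiberCount p q (s.arr 2) (s.reg 40) := by
  refine Runs.mono (T := 1 + (1 + (p * (3 + 3) + 3))) (Runs.const_seq (Runs.add_seq
    (Runs.forLoop (M := p) (fun k s' => Same 42 10 s s' ∧
      s'.reg 44 = fiberCount k q (s.arr 2) (s.reg 40) ∧ s'.reg 45 = s.reg 40 + q * k)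
    ?_ (by norm_num) (by norm_num) ?_ ?_))) (by omega) fun _ h => ⟨h.1, h.2.1⟩
  · simp [reg_setReg, h0]
  · refine ⟨((((Same.refl _ _ _).setReg _ (by omega)).setReg _ (by omega)).setReg _
      (by omega)).setReg _ (by omega), ?_, ?_⟩
    · simp [reg_setReg, fiberCount]
    · simp [reg_setReg, h7]
  · rintro k hk s' ⟨hs, h44, h45⟩ h42
    refine Runs.load_seq (Runs.add_seq (Runs.add ⟨?_, ?_, ?_, ?_, ?_, ?_⟩))
    · simp [reg_setReg, hs.reg 3 (by omega), h3]
    · simp [reg_setReg, h42]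
    · simp [reg_setReg, hs.reg 0 (by omega), h0]
    · exact ((((hs.setReg _ (by omega)).setReg _ (by omega)).setReg _ (by omega)).setReg _
        (by omega)).setReg _ (by omega)
    · simp [reg_setReg, h44, h45, hs.arr 2 (by omega), fiberCount, Finset.sum_range_succ]
    · simp [reg_setReg, h45, hs.reg 26 (by omega), h26]; ring

/-- Replace the indicator function in the array `2` by the one of the heavy residues, and put the
fibre counts into the array `3`. -/
def heavyLoop : Prog :=
  forLoop 40 41 26 (countFiber ;; .store 3 40 44 ;; .sub 47 44 27 ;;
    .ite 47 (.store 2 40 3) (.store 2 40 7))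

theorem runs_heavyLoop {s : Store} {p q T : ℕ} (h0 : s.reg 0 = p) (h3 : s.reg 3 = 1)
    (h7 : s.reg 7 = 0) (h26 : s.reg 26 = q) (h27 : s.reg 27 = T) :
    Runs heavyLoop (q * (6 * p + 12) + 3) s fun s' => Same 40 2 s s' ∧
      (∀ y < q, s'.arr 2 y = heavyResidues p q T (s.arr 2) y) ∧
      ∀ y < q, s'.arr 3 y = fiberCount p q (s.arr 2) y := by
  refine Runs.mono (T := q * (6 * p + 5 + (1 + (1 + (1 + 1))) + 3) + 3)
    (Runs.forLoop (M := q) (fun k s' => Same 40 2 s s' ∧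
      (∀ y < k, s'.arr 2 y = heavyResidues p q T (s.arr 2) y) ∧
      (∀ y, k ≤ y → s'.arr 2 y = s.arr 2 y) ∧
      ∀ y < k, s'.arr 3 y = fiberCount p q (s.arr 2) y)
    h26 (by norm_num) (by norm_num) ?_ ?_) (by ring_nf; omega) fun _ h => ⟨h.1, h.2.1, h.2.2.2⟩
  · exact ⟨((Same.refl _ _ _).setReg _ (by omega)).setReg _ (by omega), by simp,
      by simp [arr_setReg], by simp⟩
  · rintro k hk s' ⟨hs, hlt, hge, hC⟩ h40
    refine Runs.seq (runs_countFiber (p := p) (q := q) ?_ ?_ ?_ ?_) ?_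
    · rw [hs.reg 0 (by omega), h0]
    · rw [hs.reg 3 (by omega), h3]
    · rw [hs.reg 7 (by omega), h7]
    · rw [hs.reg 26 (by omega), h26]
    rintro s₁ ⟨hs₁, h44⟩
    -- Overwriting array `2` in place is safe: the fibre of `k` uses only cells with index at least
    -- `k`, which still hold the old values.
    have hcount : fiberCount p q (s'.arr 2) (s'.reg 40) = fiberCount p q (s.arr 2) k := by
      rw [h40]
      exact Finset.sum_congr rfl fun t _ => hge _ (by omega)
    rw [hcount] at h44
    have h40' : s₁.reg 40 = k := by rw [hs₁.reg 40 (by omega), h40]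
    have hs₂ : Same 40 2 s s₁ := hs.trans (hs₁.mono (by omega) (by omega))
    have ha2 : s₁.arr 2 = s'.arr 2 := hs₁.arr 2 (by omega)
    have ha3 : s₁.arr 3 = s'.arr 3 := hs₁.arr 3 (by omega)
    have h3' : s₁.reg 3 = 1 := by rw [hs₂.reg 3 (by omega), h3]
    have h7' : s₁.reg 7 = 0 := by rw [hs₂.reg 7 (by omega), h7]
    have h26' : s₁.reg 26 = q := by rw [hs₂.reg 26 (by omega), h26]
    have h27' : s₁.reg 27 = T := by rw [hs₂.reg 27 (by omega), h27]
    have key : ∀ s₂ : Store, s₂.reg 3 = 1 → s₂.reg 40 = k → s₂.reg 26 = q → Same 40 2 s s₂ →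
        (∀ y, s₂.arr 2 y = if y = k then heavyResidues p q T (s.arr 2) k else s₁.arr 2 y) →
        (∀ y, s₂.arr 3 y = if y = k then fiberCount p q (s.arr 2) k else s₁.arr 3 y) →
        s₂.reg 3 = 1 ∧ s₂.reg 40 = k ∧ s₂.reg 26 = q ∧
        (Same 40 2 s ((s₂.setReg 40 (k + 1)).setReg 41 (q - (k + 1))) ∧
        (∀ y < k + 1, s₂.arr 2 y = heavyResidues p q T (s.arr 2) y) ∧
        (∀ y, k + 1 ≤ y → s₂.arr 2 y = s.arr 2 y) ∧
        ∀ y < k + 1, s₂.arr 3 y = fiberCount p q (s.arr 2) y) := by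
      intro s₂ e3 e40 e26 hs₃ e2 e4
      refine ⟨e3, e40, e26, (hs₃.setReg _ (by omega)).setReg _ (by omega), fun y hy => ?_,
        fun y hy => ?_, fun y hy => ?_⟩
      · rw [e2]
        split_ifs with h
        · rw [h]
        · rw [ha2, hlt y (by omega)]
      · rw [e2, if_neg (by omega), ha2, hge y (by omega)]
      · rw [e4]
        split_ifs with h
        · rw [h]
        · rw [ha3, hC y (by omega)]
    refine Runs.store_seq (Runs.sub_seq (Runs.ite (fun h => Runs.store ?_) fun h => Runs.store ?_))
    · simp only [reg_setReg, reg_setArr, if_true, h44, h27'] at h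
      refine key _ ?_ ?_ ?_ ?_ ?_ ?_
      · simp [reg_setReg, reg_setArr, h3']
      · simp [reg_setReg, reg_setArr, h40']
      · simp [reg_setReg, reg_setArr, h26']
      · exact ((hs₂.setArr _ _ (by omega)).setReg _ (by omega)).setArr _ _ (by omega)
      · intro y
        simp [reg_setReg, reg_setArr, arr_setArr, arr_setReg, h40', h3', heavyResidues,
          show T < fiberCount p q (s.arr 2) k by omega]
      · intro y
        simp [reg_setArr, arr_setArr, arr_setReg, h40', h44]
    · simp only [reg_setReg, reg_setArr, if_true, h44, h27'] at h
      refine key _ ?_ ?_ ?_ ?_ ?_ ?_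
      · simp [reg_setReg, reg_setArr, h3']
      · simp [reg_setReg, reg_setArr, h40']
      · simp [reg_setReg, reg_setArr, h26']
      · exact ((hs₂.setArr _ _ (by omega)).setReg _ (by omega)).setArr _ _ (by omega)
      · intro y
        simp [reg_setReg, reg_setArr, arr_setArr, arr_setReg, h40', h7', heavyResidues,
          show ¬ T < fiberCount p q (s.arr 2) k by omega]
      · intro y
        simp [reg_setArr, arr_setArr, arr_setReg, h40', h44]

end Ram

/-- Needed because a descent rewrites array `2` only below the new modulus and leaves old values
above it. -/
theorem inDigitClosure_congr {p k D u : ℕ} {a b : ℕ → ℕ} (hp : 0 < p)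
    (hab : ∀ v < p ^ k, a v = b v) (hu : u < p ^ k) :
    InDigitClosure p k a D u ↔ InDigitClosure p k b D u := by
  induction k generalizing D u a b with
  | zero => rw [InDigitClosure, InDigitClosure, hab u hu]
  | succ k ih =>
    have hq : 0 < p ^ k := pow_pos hp k
    have hcount : ∀ y < p ^ k, fiberCount p (p ^ k) a y = fiberCount p (p ^ k) b y := by
      intro y hy
      refine Finset.sum_congr rfl fun t ht => hab _ ?_
      have := Nat.mul_le_mul_left (p ^ k) (Nat.succ_le_of_lt (Finset.mem_range.1 ht))
      rw [Nat.mul_succ] at this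
      rw [pow_succ]; omega
    rw [InDigitClosure, InDigitClosure, hab u hu, hcount _ (Nat.mod_lt _ hq)]
    rw [ih (b := heavyResidues p (p ^ k) (D / p ^ k) b)
      (fun y hy => by rw [heavyResidues, heavyResidues, hcount y hy]) (Nat.mod_lt _ hq)]

/-! ### The recursion on digits as a loop. -/

namespace Ram

/-- Pass from one digit to the next. -/
def descend : Prog :=
  check ;;
  .add 60 24 7 ;; .add 61 0 7 ;; divMod ;; .add 26 62 7 ;;
  .add 60 21 7 ;; .add 61 26 7 ;; divMod ;; .add 27 62 7 ;; .add 21 60 7 ;;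
  .add 60 22 7 ;; .add 61 26 7 ;; divMod ;; .add 22 60 7 ;;
  heavyLoop ;;
  .load 29 3 22 ;; .sub 29 27 29 ;; .ite 29 (.const 23 0) (.const 29 0) ;;
  .add 24 26 7 ;; .sub 25 24 3

/-- The state while the closure of the set with indicator function `a` is computed. -/
structure DescendState (p k : ℕ) (D u : ℕ) (s : Store) : Prop where
  p_eq : s.reg 0 = p
  one : s.reg 3 = 1
  zero : s.reg 7 = 0
  D_eq : s.reg 21 = D
  u_eq : s.reg 22 = u
  q_eq : s.reg 24 = p ^ k
  -- For `p > 1` this is zero exactly when no digit is left.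
  test : s.reg 25 = p ^ k - 1

theorem runs_descend {s : Store} {p k D u : ℕ} (hp : 0 < p)
    (hs : DescendState p (k + 1) D u s) :
    Runs descend (5 * p ^ (k + 1) + 5 * D + 5 * u + p ^ k * (6 * p + 12) + 35) s fun s' =>
      Same 20 2 s s' ∧ DescendState p k (D % p ^ k) (u % p ^ k) s' ∧
      (∀ y < p ^ k, s'.arr 2 y = heavyResidues p (p ^ k) (D / p ^ k) (s.arr 2) y) ∧
      (s'.reg 20 ≠ 0 ↔ s.reg 20 ≠ 0 ∨ (s.reg 23 ≠ 0 ∧ s.arr 2 u ≠ 0)) ∧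
      (s'.reg 23 ≠ 0 ↔ s.reg 23 ≠ 0 ∧
        D / p ^ k ≤ fiberCount p (p ^ k) (s.arr 2) (u % p ^ k)) := by
  have hq : 0 < p ^ k := pow_pos hp k
  obtain ⟨h0, h3, h7, h21, h22, h24, h25⟩ := hs
  refine Runs.mono (T := 4 + (1 + (1 + (5 * p ^ (k + 1) + 4 + (1 + (1 + (1 + (5 * D + 4 + (1 + (1 +
    (1 + (1 + (5 * u + 4 + (1 + (p ^ k * (6 * p + 12) + 3 + (1 + (1 + (1 + 1 + (1 + 1)))))))))))))))))))
    ?_ (by omega) fun _ h => h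
  refine Runs.seq (runs_check s) ?_
  rintro s₁ ⟨hs₁, hr₁, ha₁, hc₁⟩
  rw [h22] at hc₁
  refine Runs.add_seq (Runs.add_seq (Runs.seq
    (runs_divMod (x := p ^ (k + 1)) (q := p) ?_ ?_ ?_ hp) ?_))
  · simp [reg_setReg, hr₁, h3]
  · simp [reg_setReg, hr₁, h24, h7]
  · simp [reg_setReg, hr₁, h0, h7]
  rintro s₂ ⟨hr₂, ha₂, -, hq₂⟩
  rw [pow_succ, Nat.mul_div_cancel _ hp] at hq₂
  simp only [arr_setReg] at ha₂
  replace hr₂ : ∀ r < 60, s₂.reg r = s₁.reg r := fun r hr => by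
    rw [hr₂ r hr]; simp only [reg_setReg]; repeat rw [if_neg (by omega)]
  refine Runs.add_seq (Runs.add_seq (Runs.add_seq (Runs.seq
    (runs_divMod (x := D) (q := p ^ k) ?_ ?_ ?_ hq) ?_)))
  · simp [reg_setReg, hr₂, hr₁, h3]
  · simp [reg_setReg, hr₂, hr₁, h21, h7]
  · simp [reg_setReg, hr₂, hr₁, hq₂, h7]
  rintro s₃ ⟨hr₃, ha₃, hm₃, hd₃⟩
  simp only [arr_setReg] at ha₃
  have h26₃ : s₃.reg 26 = p ^ k := by
    rw [hr₃ 26 (by omega)]; simp [reg_setReg, hr₂, hr₁, hq₂, h7]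
  replace hr₃ : ∀ r < 60, r ≠ 26 → s₃.reg r = s₁.reg r := fun r hr hr' => by
    rw [hr₃ r hr]; simp only [reg_setReg]; repeat rw [if_neg (by omega)]
    exact hr₂ r hr
  refine Runs.add_seq (Runs.add_seq (Runs.add_seq (Runs.add_seq (Runs.seq
    (runs_divMod (x := u) (q := p ^ k) ?_ ?_ ?_ hq) ?_))))
  · simp [reg_setReg, hr₃, hr₁, h3]
  · simp [reg_setReg, hr₃, hr₁, h22, h7]
  · simp [reg_setReg, hr₃, hr₁, h26₃, h7]
  rintro s₄ ⟨hr₄, ha₄, hm₄, -⟩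
  simp only [arr_setReg] at ha₄
  have h26₄ : s₄.reg 26 = p ^ k := by
    rw [hr₄ 26 (by omega)]; simp [reg_setReg, h26₃]
  have h27₄ : s₄.reg 27 = D / p ^ k := by
    rw [hr₄ 27 (by omega)]; simp [reg_setReg, hd₃, hr₃, hr₁, h7]
  have h21₄ : s₄.reg 21 = D % p ^ k := by
    rw [hr₄ 21 (by omega)]; simp [reg_setReg, hm₃, hr₃, hr₁, h7]
  replace hr₄ : ∀ r < 60, r ≠ 26 → r ≠ 27 → r ≠ 21 → s₄.reg r = s₁.reg r :=
    fun r hr h h' h'' => by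
      rw [hr₄ r hr]; simp only [reg_setReg]; repeat rw [if_neg (by omega)]
      exact hr₃ r hr h
  have ha₄' : s₄.arr = s.arr := by rw [ha₄, ha₃, ha₂, ha₁]
  refine Runs.add_seq (Runs.seq
    (runs_heavyLoop (p := p) (q := p ^ k) (T := D / p ^ k) ?_ ?_ ?_ ?_ ?_) ?_)
  · simp [reg_setReg, hr₄, hr₁, h0]
  · simp [reg_setReg, hr₄, hr₁, h3]
  · simp [reg_setReg, hr₄, hr₁, h7]
  · simp [reg_setReg, h26₄]
  · simp [reg_setReg, h27₄]
  rintro s₅ ⟨hs₅, hA, hC⟩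
  simp only [arr_setReg, ha₄'] at hA hC
  have h22₅ : s₅.reg 22 = u % p ^ k := by
    rw [hs₅.reg 22 (by omega)]; simp [reg_setReg, hm₄, hr₄, hr₁, h7]
  have h26₅ : s₅.reg 26 = p ^ k := by
    rw [hs₅.reg 26 (by omega)]; simp [reg_setReg, h26₄]
  have h27₅ : s₅.reg 27 = D / p ^ k := by
    rw [hs₅.reg 27 (by omega)]; simp [reg_setReg, h27₄]
  have h21₅ : s₅.reg 21 = D % p ^ k := by
    rw [hs₅.reg 21 (by omega)]; simp [reg_setReg, h21₄]
  have hr₅ : ∀ r < 40, r ≠ 26 → r ≠ 27 → r ≠ 21 → r ≠ 22 → s₅.reg r = s₁.reg r := by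
    intro r hr h h' h'' h3'
    rw [hs₅.reg r hr, reg_setReg, if_neg h3', hr₄ r (by omega) h h' h'']
  have hs₁₅ : Same 20 2 s s₅ := by
    refine ⟨fun r hr => ?_, fun a ha => ?_⟩
    · rw [hr₅ r (by omega) (by omega) (by omega) (by omega) (by omega), hs₁.reg r hr]
    · rw [hs₅.arr a ha, arr_setReg, ha₄']
  have h0₅ : s₅.reg 0 = p := by rw [hs₁₅.reg 0 (by omega), h0]
  have h3₅ : s₅.reg 3 = 1 := by rw [hs₁₅.reg 3 (by omega), h3]
  have h7₅ : s₅.reg 7 = 0 := by rw [hs₁₅.reg 7 (by omega), h7]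
  have h20₅ : s₅.reg 20 = s₁.reg 20 :=
    hr₅ 20 (by omega) (by omega) (by omega) (by omega) (by omega)
  have h23₅ : s₅.reg 23 = s.reg 23 := by
    rw [hr₅ 23 (by omega) (by omega) (by omega) (by omega) (by omega), hr₁ 23 (by omega) (by omega)]
  have h29 : ((s₅.setReg 29 (s₅.arr 3 (s₅.reg 22))).setReg 29
      ((s₅.setReg 29 (s₅.arr 3 (s₅.reg 22))).reg 27 -
        (s₅.setReg 29 (s₅.arr 3 (s₅.reg 22))).reg 29)).reg 29 =
      D / p ^ k - fiberCount p (p ^ k) (s.arr 2) (u % p ^ k) := by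
    simp [reg_setReg, h22₅, h27₅, hC _ (Nat.mod_lt u hq)]
  refine Runs.load_seq (Runs.sub_seq (Runs.seq (Q' := fun s' => Same 20 2 s s' ∧
    s'.arr 2 = s₅.arr 2 ∧ s'.reg 26 = p ^ k ∧ s'.reg 21 = D % p ^ k ∧ s'.reg 22 = u % p ^ k ∧
    s'.reg 20 = s₁.reg 20 ∧ (s'.reg 23 ≠ 0 ↔ s.reg 23 ≠ 0 ∧
        D / p ^ k ≤ fiberCount p (p ^ k) (s.arr 2) (u % p ^ k)))
    (Runs.ite (fun h => Runs.const ?_) (fun h => Runs.const ?_)) ?_))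
  · rw [h29] at h
    refine ⟨((hs₁₅.setReg _ (by omega)).setReg _ (by omega)).setReg _ (by omega), rfl, ?_, ?_, ?_,
      ?_, ?_⟩
    · simp [reg_setReg, h26₅]
    · simp [reg_setReg, h21₅]
    · simp [reg_setReg, h22₅]
    · simp [reg_setReg, h20₅]
    · simp only [reg_setReg]; simp; omega
  · rw [h29] at h
    refine ⟨((hs₁₅.setReg _ (by omega)).setReg _ (by omega)).setReg _ (by omega), rfl, ?_, ?_, ?_,
      ?_, ?_⟩
    · simp [reg_setReg, h26₅]
    · simp [reg_setReg, h21₅]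
    · simp [reg_setReg, h22₅]
    · simp [reg_setReg, h20₅]
    · simp [reg_setReg, h23₅]; omega
  · rintro s₆ ⟨hs₆, ha₆, h26₆, h21₆, h22₆, h20₆, h23₆⟩
    have h0₆ : s₆.reg 0 = p := by rw [hs₆.reg 0 (by omega), h0]
    have h3₆ : s₆.reg 3 = 1 := by rw [hs₆.reg 3 (by omega), h3]
    have h7₆ : s₆.reg 7 = 0 := by rw [hs₆.reg 7 (by omega), h7]
    refine Runs.add_seq (Runs.sub ⟨(hs₆.setReg _ (by omega)).setReg _ (by omega),
      ⟨?_, ?_, ?_, ?_, ?_, ?_, ?_⟩, ?_, ?_, ?_⟩)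
    · simp [reg_setReg, h0₆]
    · simp [reg_setReg, h3₆]
    · simp [reg_setReg, h7₆]
    · simp [reg_setReg, h21₆]
    · simp [reg_setReg, h22₆]
    · simp [reg_setReg, h26₆, h7₆]
    · simp [reg_setReg, h26₆, h7₆, h3₆]
    · intro y hy
      rw [arr_setReg, arr_setReg, ha₆, hA y hy]
    · rw [← hc₁, ← h20₆]; simp [reg_setReg]
    · rw [← h23₆]; simp [reg_setReg]

/-- The recursion has the form "`A` or (`B` and recursive call)", so two flags replace a stack:
register `20` records success, register `23` that all side conditions held so far. The statement
"`20`, or `23` and the remaining closure" is invariant; the final `check` settles the case without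
digits. -/
theorem runs_descend_loop {p k D u B W : ℕ} (hp : 1 < p) {s : Store} (hs : DescendState p k D u s)
    (hD : D < p ^ k) (hu : u < p ^ k) (hB : p ^ k ≤ B)
    (hW : 15 * B + B * (6 * B + 12) + 36 ≤ W) :
    Runs (.while 25 descend ;; check) (k * W + 5) s fun s' => Same 20 2 s s' ∧
      (s'.reg 20 ≠ 0 ↔
        s.reg 20 ≠ 0 ∨ (s.reg 23 ≠ 0 ∧ InDigitClosure p k (s.arr 2) D u)) := by
  have loop : Runs (.while 25 descend) (k * W + 1) s fun s' => Same 20 2 s s' ∧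
      ((s'.reg 20 ≠ 0 ∨ (s'.reg 23 ≠ 0 ∧ s'.arr 2 (s'.reg 22) ≠ 0)) ↔
        s.reg 20 ≠ 0 ∨ (s.reg 23 ≠ 0 ∧ InDigitClosure p k (s.arr 2) D u)) := by
    induction k generalizing D u s with
    | zero =>
      refine (Runs.while_false (by simp [hs.test]) ?_).mono (by omega) fun _ h => h
      exact ⟨Same.refl _ _ _, by rw [hs.u_eq, InDigitClosure]⟩
    | succ k ih =>
      have hq : 0 < p ^ k := pow_pos (by omega) k
      have h1 : 1 < p ^ (k + 1) := Nat.one_lt_pow (by omega) hp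
      have hqB : p ^ k ≤ B := (Nat.pow_le_pow_right (by omega) (by omega)).trans hB
      have hpB : p ≤ B := le_trans (Nat.le_self_pow (by omega) p) hB
      have hcost : 5 * p ^ (k + 1) + 5 * D + 5 * u + p ^ k * (6 * p + 12) + 35 + 1 ≤ W := by
        have : p ^ k * (6 * p + 12) ≤ B * (6 * B + 12) := Nat.mul_le_mul hqB (by omega)
        omega
      have htime : 5 * p ^ (k + 1) + 5 * D + 5 * u + p ^ k * (6 * p + 12) + 35 + (k * W + 1) + 1 ≤
          (k + 1) * W + 1 := by
        have : (k + 1) * W = k * W + W := by ring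
        omega
      have htest : s.reg 25 ≠ 0 := by rw [hs.test]; omega
      refine (Runs.while_true htest ((runs_descend (by omega) hs).mono le_rfl ?_)).mono htime
        fun _ h => h
      · rintro s' ⟨hs', hst, hA, h20, h23⟩
        refine (ih hst (Nat.mod_lt _ hq) (Nat.mod_lt _ hq) hqB).mono le_rfl ?_
        rintro s'' ⟨hs'', h⟩
        have hcongr := inDigitClosure_congr (p := p) (k := k) (D := D % p ^ k) (u := u % p ^ k)
          (a := s'.arr 2) (b := heavyResidues p (p ^ k) (D / p ^ k) (s.arr 2)) (by omega) hA
          (Nat.mod_lt _ hq)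
        refine ⟨hs'.trans hs'', h.trans ?_⟩
        rw [h20, h23, hcongr, InDigitClosure, or_assoc, and_assoc, and_or_left]
  refine Runs.mono (Runs.seq loop (T' := 4) ?_) (by omega) fun _ h => h
  rintro s' ⟨hs', h⟩
  refine (runs_check s').mono le_rfl ?_
  rintro s'' ⟨hs'', -, -, h20⟩
  exact ⟨hs'.trans hs'', h20.trans h⟩

end Ram

/-! ### The test for one pair of indices, and the complete algorithm. -/

/-- The indicator function of the residues modulo `Q` of the numbers `e - i` for `e ∈ E`. -/
def residueIndicator (Q i : ℕ) (E : Finset ℕ) (v : ℕ) : ℕ :=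
  if ∃ e ∈ E, (e - i) % Q = v then 1 else 0

namespace Ram

/-- The state after the preparations, with `Q` for the modulus. -/
structure GlobalState (p n d Q : ℕ) (E : Finset ℕ) (s : Store) : Prop where
  p_eq : s.reg 0 = p
  n_eq : s.reg 1 = n
  d_eq : s.reg 2 = d
  one : s.reg 3 = 1
  Q_eq : s.reg 4 = Q
  n_succ : s.reg 5 = n + 1
  d_succ : s.reg 6 = d + 1
  zero : s.reg 7 = 0
  E_eq : ∀ e, s.arr 0 e = if e ∈ E then 1 else 0

/-- Inner routines write only to higher registers and arrays, so the global data survive them. -/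
theorem GlobalState.of_same {p n d Q : ℕ} {E : Finset ℕ} {s s' : Store}
    (h : GlobalState p n d Q E s) (hs : Same 10 1 s s') : GlobalState p n d Q E s' where
  p_eq := (hs.reg 0 (by omega)).trans h.p_eq
  n_eq := (hs.reg 1 (by omega)).trans h.n_eq
  d_eq := (hs.reg 2 (by omega)).trans h.d_eq
  one := (hs.reg 3 (by omega)).trans h.one
  Q_eq := (hs.reg 4 (by omega)).trans h.Q_eq
  n_succ := (hs.reg 5 (by omega)).trans h.n_succ
  d_succ := (hs.reg 6 (by omega)).trans h.d_succ
  zero := (hs.reg 7 (by omega)).trans h.zero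
  E_eq := fun e => by rw [hs.arr 0 (by omega), h.E_eq]

/-- Clear the cells of the array `2` below the modulus. -/
def clearResidues : Prog := forLoop 40 41 4 (.store 2 40 7)

/-- Mark the residues of the shifted elements of `E` in the array `2`. -/
def markResidues : Prog :=
  forLoop 40 41 5 (.load 42 0 40 ;;
    .ite 42 (.sub 60 40 10 ;; .add 61 4 7 ;; divMod ;; .store 2 60 3) (.const 42 0))

theorem runs_clearResidues {p n d Q : ℕ} {E : Finset ℕ} {s : Store}
    (hs : GlobalState p n d Q E s) :
    Runs clearResidues (Q * 4 + 3) s fun s' => Same 40 2 s s' ∧ ∀ v < Q, s'.arr 2 v = 0 := by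
  refine Runs.forLoop (T := 1) (M := Q) (fun k s' => Same 40 2 s s' ∧ ∀ v < k, s'.arr 2 v = 0)
    hs.Q_eq (by norm_num) (by norm_num) ?_ ?_
  · exact ⟨((Same.refl _ _ _).setReg _ (by omega)).setReg _ (by omega), by simp⟩
  · rintro k hk s' ⟨hs', h⟩ h40
    have hg := hs.of_same (hs'.mono (by omega) (by omega))
    refine Runs.store ⟨hg.one, h40, hg.Q_eq,
      ((hs'.setArr _ _ (by omega)).setReg _ (by omega)).setReg _ (by omega), fun v hv => ?_⟩
    rw [arr_setReg, arr_setReg, arr_setArr, h40, hg.zero]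
    split_ifs with h1
    · rfl
    · exact h v (by omega)

theorem runs_markResidues {p n d Q i : ℕ} {E : Finset ℕ} {s : Store}
    (hs : GlobalState p n d Q E s) (hE : ∀ e ∈ E, e ≤ n) (hQ : 0 < Q) (hi : s.reg 10 = i)
    (h2 : ∀ v < Q, s.arr 2 v = 0) :
    Runs markResidues ((n + 1) * (5 * n + 12) + 3) s fun s' => Same 40 2 s s' ∧
      ∀ v < Q, s'.arr 2 v = residueIndicator Q i E v := by
  refine Runs.mono (T := (n + 1) * (5 * n + 9 + 3) + 3) (Runs.forLoop (M := n + 1)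
    (fun k s' => Same 40 2 s s' ∧
      ∀ v < Q, s'.arr 2 v = residueIndicator Q i (E.filter (· < k)) v)
    hs.n_succ (by norm_num) (by norm_num) ?_ ?_) le_rfl ?_
  · refine ⟨((Same.refl _ _ _).setReg _ (by omega)).setReg _ (by omega), fun v hv => ?_⟩
    simp [arr_setReg, h2 v hv, residueIndicator]
  · rintro k hk s' ⟨hs', h⟩ h40
    have hg := hs.of_same (hs'.mono (by omega) (by omega))
    refine Runs.mono (T := 1 + ((1 + (1 + ((5 * n + 4) + 1))) + 1)) (Runs.load_seq
      (Runs.ite (fun h42 => Runs.sub_seq (Runs.add_seq (Runs.seq ((runs_divMod (x := k - i)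
        (q := Q) ?_ ?_ ?_ hQ).mono (by omega) fun _ h => h) ?_)))
      fun h42 => Runs.mono (Runs.const ?_) (by omega) fun _ h => h)) (by omega) fun _ h => h
    · simp [reg_setReg, hg.one]
    · simp [reg_setReg, h40, hs'.reg 10 (by omega), hi]
    · simp [reg_setReg, hg.Q_eq, hg.zero]
    · rintro s₁ ⟨hr₁, ha₁, h60, -⟩
      simp only [reg_setReg, if_true, h40, hg.E_eq] at h42
      have hkE : k ∈ E := by
        by_contra hkE
        simp [hkE] at h42
      simp only [arr_setReg] at ha₁
      have hs₁ : Same 40 2 s s₁ := by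
        refine ⟨fun r hr => ?_, fun a ha => by rw [ha₁, hs'.arr a ha]⟩
        rw [hr₁ r (by omega)]
        simp only [reg_setReg]; repeat rw [if_neg (by omega)]
        exact hs'.reg r hr
      have hg₁ := hs.of_same (hs₁.mono (by omega) (by omega))
      refine Runs.store ⟨hg₁.one, ?_, hg₁.n_succ,
        ((hs₁.setArr _ _ (by omega)).setReg _ (by omega)).setReg _ (by omega), fun v hv => ?_⟩
      · rw [reg_setArr, hr₁ 40 (by omega)]; simp [reg_setReg, h40]
      · rw [arr_setReg, arr_setReg, arr_setArr, h60, hg₁.one, ha₁, h v hv]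
        rw [residueIndicator, residueIndicator]
        by_cases hv' : v = (k - i) % Q
        · rw [if_pos ⟨rfl, hv'⟩, if_pos ⟨k, Finset.mem_filter.2 ⟨hkE, by omega⟩, hv'.symm⟩]
        · rw [if_neg fun h => hv' h.2]
          refine if_congr ⟨?_, ?_⟩ rfl rfl
          · rintro ⟨e, he, hev⟩
            obtain ⟨he, hek⟩ := Finset.mem_filter.1 he
            exact ⟨e, Finset.mem_filter.2 ⟨he, by omega⟩, hev⟩
          · rintro ⟨e, he, hev⟩
            obtain ⟨he, hek⟩ := Finset.mem_filter.1 he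
            have : e ≠ k := by rintro rfl; exact hv' hev.symm
            exact ⟨e, Finset.mem_filter.2 ⟨he, by omega⟩, hev⟩
    · simp only [reg_setReg, if_true, h40, hg.E_eq] at h42
      have hkE : k ∉ E := by
        intro hkE
        simp [hkE] at h42
      refine ⟨?_, ?_, ?_, (((hs'.setReg _ (by omega)).setReg _ (by omega)).setReg _
        (by omega)).setReg _ (by omega), fun v hv => ?_⟩
      · simp [reg_setReg, hg.one]
      · simp [reg_setReg, h40]
      · simp [reg_setReg, hg.n_succ]
      · simp only [arr_setReg]
        rw [h v hv]
        congr 1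
        ext e
        simp only [Finset.mem_filter]
        refine and_congr_right fun he => ?_
        have : e ≠ k := by rintro rfl; exact hkE he
        omega
  · rintro s' ⟨hs', h⟩
    refine ⟨hs', fun v hv => ?_⟩
    rw [h v hv, Finset.filter_true_of_mem]
    intro e he
    have := hE e he
    omega

/-- Test whether the number in the register `11` passes the test for the number in the
register `10`. -/
def testIndex : Prog :=
  clearResidues ;; markResidues ;;
  .sub 21 2 10 ;; .sub 60 11 10 ;; .add 61 4 7 ;; divMod ;; .add 22 60 7 ;;
  .const 20 0 ;; .const 23 1 ;; .add 24 4 7 ;; .sub 25 24 3 ;; .while 25 descend ;; check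

/-- A bound for the number of steps of `testIndex`, for `B > n`. -/
def testTime {R : Type*} [CommSemiring R] (B : R) : R :=
  B * 4 + 3 + (B * (5 * B + 12) + 3) + (5 * B + 12) + (B * (15 * B + B * (6 * B + 12) + 36) + 5)

theorem runs_testIndex {p n d k i j : ℕ} {E : Finset ℕ} {s : Store} (hp : 1 < p)
    (hs : GlobalState p n d (p ^ k) E s) (hE : ∀ e ∈ E, e ≤ n) (hd : d < p ^ k)
    (hk : p ^ k ≤ n + 1) (hj : j ≤ n) (h10 : s.reg 10 = i) (h11 : s.reg 11 = j) :
    Runs testIndex (testTime (n + 1)) s fun s' => Same 20 2 s s' ∧ (s'.reg 20 ≠ 0 ↔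
      InDigitClosure p k (residueIndicator (p ^ k) i E) (d - i) ((j - i) % p ^ k)) := by
  have hQ : 0 < p ^ k := by omega
  -- The number of digits is below `p ^ k`, hence bounded by `n + 1`.
  have hkn : k ≤ n + 1 := (Nat.lt_pow_self hp).le.trans hk
  set W := 15 * (n + 1) + (n + 1) * (6 * (n + 1) + 12) + 36 with hW
  have htime : (p ^ k * 4 + 3) + ((n + 1) * (5 * n + 12) + 3 + (1 + (1 + (1 + (5 * n + 4 + (1 + (1 +
      (1 + (1 + (1 + (k * W + 5))))))))))) ≤ testTime (n + 1) := by
    have h1 : k * W ≤ (n + 1) * W := Nat.mul_le_mul_right _ hkn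
    have h2 : (n + 1) * (5 * n + 12) ≤ (n + 1) * (5 * (n + 1) + 12) :=
      Nat.mul_le_mul_left _ (by omega)
    rw [testTime, ← hW]
    omega
  refine Runs.mono (Runs.seq (runs_clearResidues hs) ?_) htime fun _ h => h
  rintro s₁ ⟨hs₁, h2₁⟩
  have hg₁ := hs.of_same (hs₁.mono (by omega) (by omega))
  refine Runs.seq (runs_markResidues hg₁ hE hQ (i := i) ?_ h2₁) ?_
  · rw [hs₁.reg 10 (by omega), h10]
  rintro s₂ ⟨hs₂, h2₂⟩
  have hs₂' := hs₁.trans hs₂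
  have hg₂ := hs.of_same (hs₂'.mono (by omega) (by omega))
  have h10₂ : s₂.reg 10 = i := by rw [hs₂'.reg 10 (by omega), h10]
  have h11₂ : s₂.reg 11 = j := by rw [hs₂'.reg 11 (by omega), h11]
  refine Runs.sub_seq (Runs.sub_seq (Runs.add_seq (Runs.seq ((runs_divMod (x := j - i)
    (q := p ^ k) ?_ ?_ ?_ hQ).mono (by omega) fun _ h => h) ?_)))
  · simp [reg_setReg, hg₂.one]
  · simp [reg_setReg, h10₂, h11₂]
  · simp [reg_setReg, hg₂.Q_eq, hg₂.zero]
  rintro s₃ ⟨hr₃, ha₃, h60, -⟩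
  simp only [arr_setReg] at ha₃
  have h21 : s₃.reg 21 = d - i := by
    rw [hr₃ 21 (by omega)]; simp [reg_setReg, hg₂.d_eq, h10₂]
  have hs₃ : Same 20 2 s s₃ := by
    refine ⟨fun r hr => ?_, fun a ha => by rw [ha₃, hs₂'.arr a ha]⟩
    rw [hr₃ r (by omega)]
    simp only [reg_setReg]; repeat rw [if_neg (by omega)]
    exact hs₂'.reg r (by omega)
  have hg₃ := hs.of_same (hs₃.mono (by omega) (by omega))
  refine Runs.add_seq (Runs.const_seq (Runs.const_seq (Runs.add_seq (Runs.sub_seq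
    ((runs_descend_loop (D := d - i) (u := (j - i) % p ^ k) hp ⟨?_, ?_, ?_, ?_, ?_, ?_, ?_⟩
      (by omega) (Nat.mod_lt _ hQ) hk hW.ge).mono le_rfl ?_)))))
  · simp [reg_setReg, hg₃.p_eq]
  · simp [reg_setReg, hg₃.one]
  · simp [reg_setReg, hg₃.zero]
  · simp [reg_setReg, h21]
  · simp [reg_setReg, h60, hg₃.zero]
  · simp [reg_setReg, hg₃.Q_eq, hg₃.zero]
  · simp [reg_setReg, hg₃.Q_eq, hg₃.zero, hg₃.one]
  · rintro s₄ ⟨hs₄, h20⟩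
    refine ⟨(((((hs₃.setReg _ (by omega)).setReg _ (by omega)).setReg _ (by omega)).setReg _
      (by omega)).setReg _ (by omega)).trans hs₄, h20.trans ?_⟩
    rw [← inDigitClosure_congr (a := s₃.arr 2) (b := residueIndicator (p ^ k) i E)
      (by omega) (fun v hv => by rw [ha₃, h2₂ v hv]) (Nat.mod_lt _ hQ)]
    simp only [reg_setReg, arr_setReg]
    simp

/-- Put `d + 1` into the register `6` and the least power of `p` that is larger than `d` into the
register `4`. -/
def computeModulus : Prog :=
  .const 4 1 ;; .add 6 2 3 ;; .sub 60 6 4 ;; .while 60 (.const 61 0 ;;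
    forLoop 62 63 0 (.add 61 61 4) ;; .add 4 61 7 ;; .sub 60 6 4)

/-- Each pass multiplies the modulus by `p` through `p` additions; the truncated difference `d + 1 -
p ^ k` is nonzero exactly for `k < ellP p d`. -/
theorem runs_computeModulus {s : Store} {p d : ℕ} (hp : 1 < p) (h0 : s.reg 0 = p)
    (h2 : s.reg 2 = d) (h3 : s.reg 3 = 1) (h7 : s.reg 7 = 0) :
    Runs computeModulus (ellP p d * (4 * p + 7) + 4) s fun s' =>
      Same 4 1 s s' ∧ s'.reg 4 = p ^ ellP p d ∧ s'.reg 6 = d + 1 ∧ s'.reg 7 = 0 := by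
  have loop : ∀ m k s', m + k = ellP p d → Same 4 1 s s' → s'.reg 4 = p ^ k →
      s'.reg 6 = d + 1 → s'.reg 7 = 0 → s'.reg 60 = d + 1 - p ^ k →
      Runs (.while 60 (.const 61 0 ;; forLoop 62 63 0 (.add 61 61 4) ;; .add 4 61 7 ;; .sub 60 6 4))
        (m * (4 * p + 7) + 1) s' fun s' =>
          Same 4 1 s s' ∧ s'.reg 4 = p ^ ellP p d ∧ s'.reg 6 = d + 1 ∧ s'.reg 7 = 0 := by
    intro m
    induction m with
    | zero =>
      intro k s' hk hs' h4 h6 h7 h60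
      obtain rfl : k = ellP p d := by omega
      have : d + 1 ≤ p ^ ellP p d := Nat.le_pow_clog hp _
      exact (Runs.while_false (by omega) ⟨hs', h4, h6, h7⟩).mono (by omega) fun _ h => h
    | succ m ih =>
      intro k s' hk hs' h4 h6 h7 h60
      have : p ^ k < d + 1 := (Nat.lt_clog_iff_pow_lt hp).1 (by rw [ellP] at hk; omega)
      refine Runs.mono (Runs.while_true (T := 1 + (p * (1 + 3) + 3 + (1 + 1)))
        (T' := m * (4 * p + 7) + 1) (by omega) (Runs.const_seq (Runs.seq
          (Runs.forLoop (M := p) (fun i s'' => Same 60 1 s' s'' ∧ s''.reg 61 = p ^ k * i)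
            ?_ (by norm_num) (by norm_num) ?_ ?_) ?_))) (by ring_nf; omega) fun _ h => h
      · simp [reg_setReg, hs'.reg 0 (by omega), h0]
      · exact ⟨(((Same.refl _ _ _).setReg _ (by omega)).setReg _ (by omega)).setReg _ (by omega),
          by simp [reg_setReg]⟩
      · rintro i hi s'' ⟨hs'', h61⟩ h62
        refine Runs.add ⟨?_, ?_, ?_, ((hs''.setReg _ (by omega)).setReg _ (by omega)).setReg _
          (by omega), ?_⟩
        · simp [reg_setReg, hs''.reg 3 (by omega), hs'.reg 3 (by omega), h3]
        · simp [reg_setReg, h62]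
        · simp [reg_setReg, hs''.reg 0 (by omega), hs'.reg 0 (by omega), h0]
        · simp [reg_setReg, h61, hs''.reg 4 (by omega), h4, mul_add]
      · rintro s'' ⟨hs'', h61⟩
        have h7'' : s''.reg 7 = 0 := by rw [hs''.reg 7 (by omega), h7]
        have h6'' : s''.reg 6 = d + 1 := by rw [hs''.reg 6 (by omega), h6]
        refine Runs.add_seq (Runs.sub (ih (k + 1) _ (by omega) (((hs'.trans (hs''.mono (by omega)
          le_rfl)).setReg _ (by omega)).setReg _ (by omega)) ?_ ?_ ?_ ?_))
        · simp [reg_setReg, h61, h7'', pow_succ]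
        · simp [reg_setReg, h6'']
        · simp [reg_setReg, h7'']
        · simp [reg_setReg, h61, h7'', h6'', pow_succ]
  refine Runs.mono (Runs.const_seq (Runs.add_seq (Runs.sub_seq (loop (ellP p d) 0 _ rfl
    ((((Same.refl _ _ _).setReg _ (by omega)).setReg _ (by omega)).setReg _ (by omega)) ?_ ?_ ?_ ?_))))
    (by omega) fun _ h => h
  · simp [reg_setReg]
  · simp [reg_setReg, h2, h3]
  · simp [reg_setReg, h7]
  · simp [reg_setReg, h2, h3]

/-- The condition that decides whether the weight `j` belongs to the closure. -/
def ClosureTest (p d : ℕ) (E : Finset ℕ) (j i : ℕ) : Prop :=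
  i ≤ j → InDigitClosure p (ellP p d) (residueIndicator (p ^ ellP p d) i E) (d - i)
    ((j - i) % p ^ ellP p d)

/-- The loop of the algorithm over `i`. -/
def indexLoop : Prog :=
  forLoop 10 12 6 (.sub 14 10 11 ;; .ite 14 (.const 14 0)
    (testIndex ;; .ite 20 (.const 14 0) (.store 1 11 7)))

/-- The algorithm for the closure of a symmetric set. -/
def closureAlgorithm : Prog :=
  .const 3 1 ;; computeModulus ;; .add 5 1 3 ;; forLoop 11 13 5 (.store 1 11 3 ;; indexLoop)

open Classical in
theorem runs_indexLoop {p n d j : ℕ} {E : Finset ℕ} {s : Store} (hp : 1 < p)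
    (hs : GlobalState p n d (p ^ ellP p d) E s) (hE : ∀ e ∈ E, e ≤ n)
    (hk : p ^ ellP p d ≤ n + 1) (hj : j ≤ n) (h11 : s.reg 11 = j) (h1 : s.arr 1 j = 1) :
    Runs indexLoop ((d + 1) * (testTime (n + 1) + 7) + 3) s fun s' => Same 10 1 s s' ∧
      s'.reg 11 = j ∧ (∀ j', j' ≠ j → s'.arr 1 j' = s.arr 1 j') ∧
      s'.arr 1 j = if ∀ i ≤ d, ClosureTest p d E j i then 1 else 0 := by
  have hd : d < p ^ ellP p d := Nat.le_pow_clog hp _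
  refine Runs.mono (T := (d + 1) * (1 + (testTime (n + 1) + (1 + 1) + 1) + 3) + 3)
    (Runs.forLoop (M := d + 1) (fun k s' => Same 10 1 s s' ∧
      s'.reg 11 = j ∧ (∀ j', j' ≠ j → s'.arr 1 j' = s.arr 1 j') ∧
      s'.arr 1 j = if ∀ i < k, ClosureTest p d E j i then 1 else 0)
    hs.d_succ (by norm_num) (by norm_num) ?_ ?_) (by ring_nf; omega) ?_
  · exact ⟨((Same.refl _ _ _).setReg _ (by omega)).setReg _ (by omega), by simp [reg_setReg, h11],
      fun _ _ => rfl, by simp [arr_setReg, h1]⟩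
  · rintro k hkd s' ⟨hs', h11', hne, h1'⟩ h10
    have key : ∀ s'' : Store, Same 10 1 s' s'' → s''.reg 10 = k → s''.reg 11 = j →
        (∀ j', j' ≠ j → s''.arr 1 j' = s'.arr 1 j') →
        (s''.arr 1 j = if ClosureTest p d E j k then s'.arr 1 j else 0) →
        s''.reg 3 = 1 ∧ s''.reg 10 = k ∧ s''.reg 6 = d + 1 ∧
          (Same 10 1 s ((s''.setReg 10 (k + 1)).setReg 12 (d + 1 - (k + 1))) ∧
          ((s''.setReg 10 (k + 1)).setReg 12 (d + 1 - (k + 1))).reg 11 = j ∧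
          (∀ j', j' ≠ j → s''.arr 1 j' = s.arr 1 j') ∧
          s''.arr 1 j = if ∀ i < k + 1, ClosureTest p d E j i then 1 else 0) := by
      intro s'' hs'' e10 e11 ene e1
      have hg := hs.of_same (hs'.trans hs'')
      refine ⟨hg.one, e10, hg.d_succ, ((hs'.trans hs'').setReg _ (by omega)).setReg _ (by omega),
        by simp [reg_setReg, e11], fun j' hj' => by rw [ene j' hj', hne j' hj'], ?_⟩
      rw [e1, h1', ← ite_and]
      refine if_congr ?_ rfl rfl
      rw [Nat.forall_lt_succ_right, and_comm]
    have hg := hs.of_same hs'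
    refine Runs.sub_seq (Runs.ite (fun h14 => Runs.mono (Runs.const ?_) (by omega) fun _ h => h)
      fun h14 => Runs.seq (runs_testIndex (i := k) (j := j) hp (hg.of_same
        ((Same.refl _ _ _).setReg _ (by omega))) hE hd hk hj ?_ ?_) ?_)
    · simp only [reg_setReg, if_true, h10, h11'] at h14
      refine key _ (((Same.refl _ _ _).setReg _ (by omega)).setReg _ (by omega)) ?_ ?_ ?_ ?_
      · simp [reg_setReg, h10]
      · simp [reg_setReg, h11']
      · exact fun _ _ => rfl
      -- For `j < i` the condition is vacuous and the output cell stays unchanged.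
      · rw [if_pos (show ClosureTest p d E j k from fun h => absurd h (by omega))]; rfl
    · simp [reg_setReg, h10]
    · simp [reg_setReg, h11']
    · simp only [reg_setReg, if_true, h10, h11'] at h14
      rintro s₁ ⟨hs₁, h20⟩
      have e10 : s₁.reg 10 = k := by rw [hs₁.reg 10 (by omega)]; simp [reg_setReg, h10]
      have e11 : s₁.reg 11 = j := by rw [hs₁.reg 11 (by omega)]; simp [reg_setReg, h11']
      have e1 : s₁.arr 1 = s'.arr 1 := hs₁.arr 1 (by omega)
      have hs₁' : Same 10 1 s' s₁ :=
        (((Same.refl 10 1 s').setReg _ (by omega))).trans (hs₁.mono (by omega) (by omega))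
      have hiff : ClosureTest p d E j k ↔ s₁.reg 20 ≠ 0 :=
        ⟨fun h => h20.2 (h (by omega)), fun h _ => h20.1 h⟩
      refine Runs.ite (fun h => Runs.const ?_) fun h => Runs.store ?_
      · refine key _ (hs₁'.setReg _ (by omega)) ?_ ?_ ?_ ?_
        · simp [reg_setReg, e10]
        · simp [reg_setReg, e11]
        · intro j' _; rw [arr_setReg, e1]
        · rw [if_pos (hiff.2 h), arr_setReg, e1]
      · refine key _ (hs₁'.setArr _ _ (by omega)) e10 e11 ?_ ?_
        · intro j' hj'; rw [arr_setArr, if_neg (by omega), e1]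
        · rw [if_neg fun h' => hiff.1 h' h, arr_setArr, if_pos ⟨rfl, e11.symm⟩,
            (hg.of_same hs₁').zero]
  · rintro s' ⟨hs', h11', hne, h1'⟩
    refine ⟨hs', h11', hne, h1'.trans (if_congr ?_ rfl rfl)⟩
    simp

/-- A bound for the number of steps of the algorithm, for `B = n + 1`. -/
def closureTime {R : Type*} [CommSemiring R] (B : R) : R :=
  B * (B * (testTime B + 7) + 7) + B * (4 * B + 7) + 9

open Classical in
theorem runs_closureAlgorithm {p n d : ℕ} {E : Finset ℕ} (hp : 1 < p) (hE : ∀ e ∈ E, e ≤ n)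
    (hk : p ^ ellP p d ≤ n + 1) :
    Runs closureAlgorithm (closureTime (n + 1)) (inputStore p n d E) fun s' =>
      ∀ j < n + 1, s'.arr 1 j = if ∀ i ≤ d, ClosureTest p d E j i then 1 else 0 := by
  have hd : d < p ^ ellP p d := Nat.le_pow_clog hp _
  have hell : ellP p d ≤ n + 1 := (Nat.lt_pow_self hp).le.trans hk
  have htime : 1 + (ellP p d * (4 * p + 7) + 4 + (1 +
      ((n + 1) * (1 + ((d + 1) * (testTime (n + 1) + 7) + 3) + 3) + 3))) ≤ closureTime (n + 1) := by
    -- If `d = 0`, the prime `p` may exceed `n + 1`, but then `ellP p d = 0` and no multiplication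
    -- takes place.
    have h1 : ellP p d * (4 * p + 7) ≤ (n + 1) * (4 * (n + 1) + 7) := by
      by_cases h : ellP p d = 0
      · simp [h]
      · have : p ≤ n + 1 := (Nat.le_self_pow h p).trans hk
        exact Nat.mul_le_mul hell (by omega)
    have h2 : (d + 1) * (testTime (n + 1) + 7) ≤ (n + 1) * (testTime (n + 1) + 7) :=
      Nat.mul_le_mul_right _ (by omega)
    have h3 : (n + 1) * (1 + ((d + 1) * (testTime (n + 1) + 7) + 3) + 3) ≤
        (n + 1) * ((n + 1) * (testTime (n + 1) + 7) + 7) := Nat.mul_le_mul_left _ (by omega)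
    rw [closureTime]
    omega
  refine Runs.mono (Runs.const_seq (Runs.seq (runs_computeModulus (p := p) (d := d) hp ?_ ?_ ?_ ?_)
    ?_)) htime fun _ h => h
  · simp [reg_setReg, inputStore]
  · simp [reg_setReg, inputStore]
  · simp [reg_setReg]
  · simp [reg_setReg, inputStore]
  rintro s₁ ⟨hs₁, h4, h6, h7⟩
  have hg : GlobalState p n d (p ^ ellP p d) E (s₁.setReg 5 (s₁.reg 1 + s₁.reg 3)) := by
    refine ⟨?_, ?_, ?_, ?_, ?_, ?_, ?_, ?_, ?_⟩
    · simp [reg_setReg, hs₁.reg 0 (by omega), inputStore]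
    · simp [reg_setReg, hs₁.reg 1 (by omega), inputStore]
    · simp [reg_setReg, hs₁.reg 2 (by omega), inputStore]
    · simp [reg_setReg, hs₁.reg 3 (by omega)]
    · simp [reg_setReg, h4]
    · simp [reg_setReg, hs₁.reg 1 (by omega), hs₁.reg 3 (by omega), inputStore]
    · simp [reg_setReg, h6]
    · simp [reg_setReg, h7]
    · intro e
      rw [arr_setReg, hs₁.arr 0 (by omega)]
      simp [arr_setReg, inputStore]
  refine Runs.add_seq (Runs.mono (Runs.forLoop (M := n + 1) (fun k s' =>
    GlobalState p n d (p ^ ellP p d) E s' ∧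
      ∀ j < k, s'.arr 1 j = if ∀ i ≤ d, ClosureTest p d E j i then 1 else 0)
    hg.n_succ (by norm_num) (by norm_num) ?_ ?_) le_rfl fun _ h => h.2)
  · exact ⟨hg.of_same (((Same.refl _ _ _).setReg _ (by omega)).setReg _ (by omega)), by simp⟩
  · rintro k hkn s' ⟨hg', h⟩ h11
    refine Runs.store_seq ((runs_indexLoop (j := k) hp (hg'.of_same ((Same.refl _ _ _).setArr _ _
      (by omega))) hE hk (by omega) h11 ?_).mono le_rfl ?_)
    · rw [arr_setArr, if_pos ⟨rfl, h11.symm⟩, hg'.one]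
    · rintro s'' ⟨hs'', h11', hne, h1⟩
      have hg'' := hg'.of_same (((Same.refl _ _ _).setArr _ _ (by omega)).trans hs'')
      refine ⟨hg''.one, h11', hg''.n_succ, hg''.of_same (((Same.refl _ _ _).setReg _
        (by omega)).setReg _ (by omega)), fun j hj => ?_⟩
      rw [arr_setReg, arr_setReg]
      by_cases hjk : j = k
      · rw [hjk, h1]
      · rw [hne j hjk, arr_setArr, if_neg (by omega), h j (by omega)]

end Ram

/-! ### Correctness and running time combined. -/

/-- All degrees `d - i` are below `p ^ ellP p d`, so one modulus serves every `i`, and the shifted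
sets may be replaced by their residues. -/
theorem mem_zClosure_symSet_iff_closureTest {p n d : ℕ} [Fact p.Prime] (hdn : 2 * d ≤ n)
    {E : Finset ℕ} (hE : E ⊆ Finset.Icc d (n - d)) (x : Fin n → Bool) :
    x ∈ zClosure p n d (symSet n E) ↔ ∀ i ≤ d, Ram.ClosureTest p d E (cubeWeight x) i := by
  have hd : d < p ^ ellP p d := Nat.le_pow_clog (Fact.out : p.Prime).one_lt _
  have hQ : 0 < p ^ ellP p d := by omega
  rw [mem_zClosure_symSet_iff hdn hE]
  refine forall₃_congr fun i hi _ => ?_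
  rw [inBinomialClosure_mod_iff (k := ellP p d) (by omega),
    ← inBinomialClosure_iff_inDigitClosure _ _ _ _ _ (by omega) (Nat.mod_lt _ hQ)]
  · have : (fun v => v % p ^ ellP p d) '' ((fun e => e - i) '' (E : Set ℕ)) =
        {v | v < p ^ ellP p d ∧ residueIndicator (p ^ ellP p d) i E v ≠ 0} := by
      ext v
      simp only [Set.mem_image, Finset.mem_coe, exists_exists_and_eq_and, Set.mem_ofPred_eq,
        residueIndicator, ne_eq, ite_eq_right_iff, one_ne_zero, imp_false, not_not]
      refine ⟨fun h => ⟨?_, h⟩, fun h => h.2⟩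
      obtain ⟨e, -, rfl⟩ := h
      exact Nat.mod_lt _ hQ
    rw [this]
  · intro v
    rw [residueIndicator]
    split_ifs <;> simp

theorem mainTheorem4 :
    ∃ (P : Ram.Prog) (q : Polynomial ℕ),
      ∀ (p d n : ℕ) (E : Finset ℕ), p.Prime → 4 * p ^ ellP p d - 1 ≤ n →
        E ⊆ Finset.Icc d (n - d) →
          ∃ F : Finset ℕ, F ⊆ Finset.Icc 0 n ∧
            zClosure p n d (symSet n E) = symSet n F ∧
            ∃ (t : ℕ) (s : Ram.Store), t ≤ q.eval n ∧
              Ram.Exec P (Ram.inputStore p n d E) t s ∧ Ram.Outputs s n F := by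
  classical
  -- The time bound is an expression over any commutative semiring: at `X + 1` it is the polynomial
  -- `q`, at `n + 1` the bound proved for the machine.
  refine ⟨Ram.closureAlgorithm, Ram.closureTime (Polynomial.X + 1), fun p d n E hp hn hE => ?_⟩
  have : Fact p.Prime := ⟨hp⟩
  have hd : d < p ^ ellP p d := Nat.le_pow_clog hp.one_lt _
  refine ⟨(Finset.Icc 0 n).filter fun j => ∀ i ≤ d, Ram.ClosureTest p d E j i,
    Finset.filter_subset _ _, ?_, ?_⟩
  · ext x
    have hx : cubeWeight x ≤ n := (Finset.card_le_univ _).trans_eq (Fintype.card_fin n)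
    -- Here `2 * d ≤ n` follows from `d < p ^ ellP p d` and the lower bound on `n`.
    rw [mem_zClosure_symSet_iff_closureTest (by omega) hE]
    simp [symSet, hx]
  · obtain ⟨t, ht, s, hexec, hs⟩ := Ram.runs_closureAlgorithm (n := n) (E := E) (d := d) hp.one_lt
      (fun e he => by have := Finset.mem_Icc.1 (hE he); omega) (by omega)
    refine ⟨t, s, ht.trans_eq ?_, hexec, fun j hj => ?_⟩
    · simp [Ram.closureTime, Ram.testTime]
    · rw [hs j (by omega)]
      simp [hj]
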